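/- Let $K\in\{\mathbb R,\mathbb C\}$ and let polynomials in $x,y$ have coefficients in $K$. Put $$f_1=1+2y-3x^2,\qquad f_2=24x^3-y^2-12xy-6x-4y-1,$$ and let $\triangle^*=\{(x,y)\in\mathbb R^2: f_1\ge 0,\ f_2\ge 0\}$ (the compact region bounded by two hypocycloid arcs). For real $\alpha,\beta$ let $$w_{\alpha,\beta}=\frac{(4\pi^2)^{\alpha+\beta}}{3^{2\alpha+\beta}}\,f_1^{\alpha}f_2^{\beta},\qquad \langle f,g\rangle_{w_{\alpha,\beta}}=c_{\alpha,\beta}\int_{\triangle^*}f\,\overline{g}\,w_{\alpha,\beta}\,dx\,dy,\qquad c_{\alpha,\beta}=\Big(\int_{\triangle^*}w_{\alpha,\beta}\,dx\,dy\Big)^{-1}.$$ Let $A_{11}=-6x^2+y+3x+2$, $A_{12}=A_{21}=-9xy+18x^2-6y-3$, $A_{22}=-18y^2+108x^3-54xy-27x-9y$, and let $$\mathcal L_{\alpha,\beta}=-w_{-\alpha,-\beta}\big[\partial_x\, w_{\alpha,\beta}(A_{11}\partial_x+A_{12}\partial_y)+\partial_y\, w_{\alpha,\beta}(A_{21}\partial_x+A_{22}\partial_y)\big]$$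 on the set $\{f_1>0,\ f_2>0\}$; in explicit form, as an operator on polynomials, $$\mathcal L_{\alpha,\beta}=-A_{11}\partial_x^2-2A_{12}\partial_x\partial_y-A_{22}\partial_y^2+B_1\partial_x+B_2\partial_y,$$ where $B_1=21x+12\alpha x+18\beta x+6\alpha+3$ and $B_2=18x+36\alpha x+18\beta+45y+36\beta y+18\alpha y+9$. For $k=(k_1,k_2)\in\mathbb N_0^2$ let $|k|_*=2k_1+3k_2$. The $*$-order is: $k\prec j$ if $|k|_*<|j|_*$ or $2(k_1-j_1)=3(j_2-k_2)>0$; and $k\preceq j$ if $k\prec j$ or $k=j$. Let $\Pi^*_{k}=\Pi^*_{k_1,k_2}=\mathrm{span}\{x^{j_1}y^{j_2}:(j_1,j_2)\preceq (k_1,k_2)\}$. A polynomial has leading term $c\,x^{k_1}y^{k_2}$ ($c\ne0$) if $c$ is its coefficient at $x^{k_1}y^{k_2}$ and all its monomials $x^{j_1}y^{j_2}$ satisfy $j\preceq k$. **Theorem.** Let $\alpha,\beta\ge-\tfrac12$. Then $w_{\alpha,\beta}$ is integrable on $\triangle^*$ with positive integral, and there are polynomials $P_{k_1,k_2}=P^{\alpha,\beta}_{k_1,k_2}\in\Pi^*_{k_1,k_2}$,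 $k_1,k_2\ge0$, with leading term $x^{k_1}y^{k_2}$ in the $*$-order, such that: 1. for all $k_1,k_2\ge0$, $\ \mathcal L_{\alpha,\beta}P_{k_1,k_2}=\lambda^{\alpha,\beta}_{k_1,k_2}P_{k_1,k_2}$ with $$\lambda^{\alpha,\beta}_{k_1,k_2}=\tfrac32|k|_*\big(|k|_*+5+4\alpha+6\beta\big)+\tfrac92k_2\big(k_2+1+2\beta\big),$$ both pointwise on $\{f_1>0,\ f_2>0\}$ for $\mathcal L_{\alpha,\beta}$ in divergence form and as an identity of polynomials for $\mathcal L_{\alpha,\beta}$ in explicit form; 2. $\langle P_{k},P_{j}\rangle_{w_{\alpha,\beta}}=0$ whenever $k\ne j$; 3. the family is determined by its leading terms: if $Q_{k}\in\Pi^*_{k}$ has leading term $x^{k_1}y^{k_2}$ for every $k$ and the $Q_{k}$ are mutually orthogonal with respect to $\langle\cdot,\cdot\rangle_{w_{\alpha,\beta}}$, then $Q_{k}=P_{k}$ for all $k$. Moreover, each single $P_{k}$ is the only polynomial in $\Pi^*_{k}$ with leading term $x^{k_1}y^{k_2}$ that is orthogonal to $x^{j_1}y^{j_2}$ for all $j\prec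 k$. -/

import Mathlib

open MvPolynomial MeasureTheory

noncomputable section

namespace GenJacobi

/-- The quadratic factor `1 + 2y - 3x²` in the equation of the boundary of the region. -/
def bdry₁ (z : ℝ × ℝ) : ℝ := 1 + 2 * z.2 - 3 * z.1 ^ 2

/-- The cubic factor `24x³ - y² - 12xy - 6x - 4y - 1` in the equation of the boundary. -/
def bdry₂ (z : ℝ × ℝ) : ℝ :=
  24 * z.1 ^ 3 - z.2 ^ 2 - 12 * z.1 * z.2 - 6 * z.1 - 4 * z.2 - 1

/-- The compact region bounded by the two hypocycloid arcs: both factors are nonnegative.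
This is the image of the triangle under `t ↦ (CC₁,₀,₋₁(t), CC₁,₁,₋₂(t))`, where the factors equal
`3 (SC₁,₀,₋₁)²` and `(CS₁,₁,₋₂)²`. (The product of the factors is also nonnegative on an unbounded
set where both factors are negative; that set is not part of the region.) -/
def region : Set (ℝ × ℝ) := {z | 0 ≤ bdry₁ z ∧ 0 ≤ bdry₂ z}

/-- The interior of the region, where the weight functions are smooth and positive. -/
def regionInt : Set (ℝ × ℝ) := {z | 0 < bdry₁ z ∧ 0 < bdry₂ z}

/-- The weight function `w_{α,β}`. -/
def weight (α β : ℝ) (z : ℝ × ℝ) : ℝ :=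
  (4 * Real.pi ^ 2) ^ (α + β) / (3 : ℝ) ^ (2 * α + β) * bdry₁ z ^ α * bdry₂ z ^ β

/-- `⟨f, g⟩ = c_{α,β} ∫ f ḡ w_{α,β}` over the region, with `c_{α,β} = 1 / ∫ w_{α,β}`. -/
def wInner {𝕜 : Type*} [RCLike 𝕜] (α β : ℝ) (f g : ℝ × ℝ → 𝕜) : 𝕜 :=
  (((∫ z in region, weight α β z)⁻¹ : ℝ) : 𝕜) *
    ∫ z in region, f z * (starRingEnd 𝕜) (g z) * (weight α β z : 𝕜)

/-- Partial derivative in the first variable. -/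
def dx {𝕜 : Type*} [RCLike 𝕜] (f : ℝ × ℝ → 𝕜) (z : ℝ × ℝ) : 𝕜 :=
  deriv (fun s : ℝ => f (s, z.2)) z.1

/-- Partial derivative in the second variable. -/
def dy {𝕜 : Type*} [RCLike 𝕜] (f : ℝ × ℝ → 𝕜) (z : ℝ × ℝ) : 𝕜 :=
  deriv (fun s : ℝ => f (z.1, s)) z.2

def A₁₁ (z : ℝ × ℝ) : ℝ := -6 * z.1 ^ 2 + z.2 + 3 * z.1 + 2

/-- `A₁₂ = A₂₁`. -/
def A₁₂ (z : ℝ × ℝ) : ℝ := -9 * z.1 * z.2 + 18 * z.1 ^ 2 - 6 * z.2 - 3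

def A₂₂ (z : ℝ × ℝ) : ℝ :=
  -18 * z.2 ^ 2 + 108 * z.1 ^ 3 - 54 * z.1 * z.2 - 27 * z.1 - 9 * z.2

/-- The operator `L_{α,β} = -w_{-α,-β} ∇ᵗʳ w_{α,β} Λ ∇`, with `Λ` the symmetric matrix `(A_{ij})`,
acting on functions; it is meaningful on `regionInt`. -/
def jacobiOp {𝕜 : Type*} [RCLike 𝕜] (α β : ℝ) (f : ℝ × ℝ → 𝕜) (z : ℝ × ℝ) : 𝕜 :=
  -((weight (-α) (-β) z : 𝕜) *
    (dx (fun u => (weight α β u : 𝕜) * ((A₁₁ u : 𝕜) * dx f u + (A₁₂ u : 𝕜) * dy f u)) z +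
     dy (fun u => (weight α β u : 𝕜) * ((A₁₂ u : 𝕜) * dx f u + (A₂₂ u : 𝕜) * dy f u)) z))

/-- The same operator in explicit form, as a differential operator with polynomial coefficients:
`-A₁₁ ∂ₓ² - 2 A₁₂ ∂ₓ∂ᵧ - A₂₂ ∂ᵧ² + B₁ ∂ₓ + B₂ ∂ᵧ`, where `x = X 0` and `y = X 1`. -/
def jacobiOpPoly {𝕜 : Type*} [RCLike 𝕜] (α β : ℝ) (p : MvPolynomial (Fin 2) 𝕜) :
    MvPolynomial (Fin 2) 𝕜 :=
  let x : MvPolynomial (Fin 2) 𝕜 := X 0;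
  let y : MvPolynomial (Fin 2) 𝕜 := X 1;
  let a : MvPolynomial (Fin 2) 𝕜 := C (α : 𝕜);
  let b : MvPolynomial (Fin 2) 𝕜 := C (β : 𝕜);
  -(-6 * x ^ 2 + y + 3 * x + 2) * pderiv 0 (pderiv 0 p)
    - 2 * (-9 * x * y + 18 * x ^ 2 - 6 * y - 3) * pderiv 0 (pderiv 1 p)
    - (-18 * y ^ 2 + 108 * x ^ 3 - 54 * x * y - 27 * x - 9 * y) * pderiv 1 (pderiv 1 p)
    + (21 * x + 12 * a * x + 18 * b * x + 6 * a + 3) * pderiv 0 p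
    + (18 * x + 36 * a * x + 18 * b + 45 * y + 36 * b * y + 18 * a * y + 9) * pderiv 1 p

/-- The function on the real plane given by a polynomial with coefficients in `𝕜`. -/
def polyFun {𝕜 : Type*} [RCLike 𝕜] (p : MvPolynomial (Fin 2) 𝕜) (z : ℝ × ℝ) : 𝕜 :=
  eval ![(z.1 : 𝕜), (z.2 : 𝕜)] p

/-- The `m`-degree `2 k₁ + 3 k₂` of the monomial `x^{k₁} y^{k₂}`. -/
def mDeg (k : ℕ × ℕ) : ℕ := 2 * k.1 + 3 * k.2

/-- The strict `*`-order `k ≺ j` on exponents. -/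
def StarLT (k j : ℕ × ℕ) : Prop :=
  mDeg k < mDeg j ∨
    (2 * ((k.1 : ℤ) - j.1) = 3 * ((j.2 : ℤ) - k.2) ∧ 0 < 3 * ((j.2 : ℤ) - k.2))

/-- The `*`-order `k ≼ j` on exponents. -/
def StarLE (k j : ℕ × ℕ) : Prop := StarLT k j ∨ k = j

/-- The monomial `x^{k₁} y^{k₂}`. -/
def mono (𝕜 : Type*) [RCLike 𝕜] (k : ℕ × ℕ) : MvPolynomial (Fin 2) 𝕜 :=
  X 0 ^ k.1 * X 1 ^ k.2

/-- The coefficient of `x^{k₁} y^{k₂}` in `p`. -/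
def coeffAt {𝕜 : Type*} [RCLike 𝕜] (k : ℕ × ℕ) (p : MvPolynomial (Fin 2) 𝕜) : 𝕜 :=
  coeff (Finsupp.single 0 k.1 + Finsupp.single 1 k.2) p

/-- The space `Π*_k` spanned by the monomials `x^{j₁} y^{j₂}` with `j ≼ k`. -/
def PiStar (𝕜 : Type*) [RCLike 𝕜] (k : ℕ × ℕ) : Submodule 𝕜 (MvPolynomial (Fin 2) 𝕜) :=
  Submodule.span 𝕜 {p | ∃ j, StarLE j k ∧ p = mono 𝕜 j}

/-- `c x^{k₁} y^{k₂}` is the leading term of `p` in the `*`-order. -/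
def HasLeadingTerm {𝕜 : Type*} [RCLike 𝕜] (p : MvPolynomial (Fin 2) 𝕜) (c : 𝕜) (k : ℕ × ℕ) :
    Prop :=
  c ≠ 0 ∧ coeffAt k p = c ∧ ∀ j, coeffAt j p ≠ 0 → StarLE j k

/-- The eigenvalue `λ^{α,β}_k`. -/
def eigval (α β : ℝ) (k : ℕ × ℕ) : ℝ :=
  3 / 2 * (mDeg k : ℝ) * ((mDeg k : ℝ) + 5 + 4 * α + 6 * β)
    + 9 / 2 * (k.2 : ℝ) * ((k.2 : ℝ) + 1 + 2 * β)

end GenJacobi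

end

noncomputable section

namespace GenJacobi

open Filter Topology

/-! ### Polynomials as functions on the plane and their partial derivatives. -/

section

variable {𝕜 : Type*} [RCLike 𝕜]

/-! The operator is symmetric for the weighted inner product and triangular with respect to the
`*`-order. Gram–Schmidt polynomials are then automatically eigenfunctions: if `p` has leading
monomial of exponent `k` and is orthogonal to everything below it, then `d = L p - λ p` lies in the
span of the lower monomials. Hence `⟨d, d⟩ = ⟨d, L p⟩ - λ ⟨d, p⟩ = ⟨L d, p⟩ = 0`, because `L d` is
again a lower polynomial. The eigenvalues need not be distinct.

Triangularity (`jacobiOpPoly_mono_sub_mem`) is read off the explicit form. Symmetry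
(`integral_jacobiOpPoly_symm`) rests on one algebraic fact: for each boundary factor `f`, the vector
`Λ ∇f` is `f` times a polynomial vector. This makes the logarithmic derivatives of the weight
polynomial after multiplication by `Λ`, which gives the explicit form. It also makes the flux `Λ ∇p`
tangential to the boundary, so that integration by parts leaves no boundary term, even for negative
exponents. The boundary is never parametrised: the powers in the weight are cut off near zero and a
limit is taken by dominated convergence.

The dominating function is integrable because the weight is, the extreme case being `α = β = -1/2`
(`lintegral_inv_sqrt_lt_top`). Definiteness holds since the weight is positive on a nonempty open
set, where a polynomial cannot vanish unless it is zero. The eigenfunctions are built over `ℝ` and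
then mapped to `𝕜`. -/

@[simp] lemma polyFun_add (p q : MvPolynomial (Fin 2) 𝕜) (z : ℝ × ℝ) :
    polyFun (p + q) z = polyFun p z + polyFun q z := by simp [polyFun]

@[simp] lemma polyFun_sub (p q : MvPolynomial (Fin 2) 𝕜) (z : ℝ × ℝ) :
    polyFun (p - q) z = polyFun p z - polyFun q z := by simp [polyFun]

@[simp] lemma polyFun_neg (p : MvPolynomial (Fin 2) 𝕜) (z : ℝ × ℝ) :
    polyFun (-p) z = -polyFun p z := by simp [polyFun]

@[simp] lemma polyFun_mul (p q : MvPolynomial (Fin 2) 𝕜) (z : ℝ × ℝ) :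
    polyFun (p * q) z = polyFun p z * polyFun q z := by simp [polyFun]

@[simp] lemma polyFun_smul (c : 𝕜) (p : MvPolynomial (Fin 2) 𝕜) (z : ℝ × ℝ) :
    polyFun (c • p) z = c * polyFun p z := by simp [polyFun]

@[simp] lemma polyFun_C (c : 𝕜) (z : ℝ × ℝ) : polyFun (C c) z = c := by simp [polyFun]

@[simp] lemma polyFun_zero (z : ℝ × ℝ) : polyFun (0 : MvPolynomial (Fin 2) 𝕜) z = 0 := by
  simp [polyFun]

@[simp] lemma polyFun_X_zero (z : ℝ × ℝ) :
    polyFun (X 0 : MvPolynomial (Fin 2) 𝕜) z = (z.1 : 𝕜) := by simp [polyFun]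

@[simp] lemma polyFun_X_one (z : ℝ × ℝ) :
    polyFun (X 1 : MvPolynomial (Fin 2) 𝕜) z = (z.2 : 𝕜) := by simp [polyFun]

lemma contDiff_polyFun (p : MvPolynomial (Fin 2) 𝕜) {n : WithTop ℕ∞} :
    ContDiff ℝ n (polyFun p) := by
  induction p using MvPolynomial.induction_on with
  | C a =>
    have : polyFun (C a : MvPolynomial (Fin 2) 𝕜) = fun _ => a := funext fun z => by simp
    rw [this]; exact contDiff_const
  | add p q hp hq =>
    have : polyFun (p + q) = fun z => polyFun p z + polyFun q z := funext fun z => by simp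
    rw [this]; exact hp.add hq
  | mul_X p i hp =>
    have : polyFun (p * X i) = fun z => polyFun p z * polyFun (X i) z := funext fun z => by simp
    rw [this]
    refine hp.mul ?_
    fin_cases i
    · have : polyFun (X 0 : MvPolynomial (Fin 2) 𝕜) = fun z => RCLike.ofRealCLM (K := 𝕜) z.1 :=
        funext fun z => by simp
      simp only [Fin.zero_eta, this]
      exact (RCLike.ofRealCLM (K := 𝕜)).contDiff.comp contDiff_fst
    · have : polyFun (X 1 : MvPolynomial (Fin 2) 𝕜) = fun z => RCLike.ofRealCLM (K := 𝕜) z.2 :=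
        funext fun z => by simp
      simp only [Fin.mk_one, this]
      exact (RCLike.ofRealCLM (K := 𝕜)).contDiff.comp contDiff_snd

lemma continuous_polyFun (p : MvPolynomial (Fin 2) 𝕜) : Continuous (polyFun p) :=
  (contDiff_polyFun p (n := 0)).continuous

lemma hasDerivAt_ofReal {f : ℝ → ℝ} {f' s : ℝ} (h : HasDerivAt f f' s) :
    HasDerivAt (fun t => (f t : 𝕜)) (f' : 𝕜) s := by
  simpa [Function.comp_def] using
    (RCLike.ofRealCLM (K := 𝕜)).hasFDerivAt.comp_hasDerivAt s h

lemma hasDerivAt_polyFun_fst (p : MvPolynomial (Fin 2) 𝕜) (z : ℝ × ℝ) :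
    HasDerivAt (fun s : ℝ => polyFun p (s, z.2)) (polyFun (pderiv 0 p) z) z.1 := by
  induction p using MvPolynomial.induction_on with
  | C a => simpa using hasDerivAt_const z.1 a
  | add p q hp hq =>
    exact (hp.add hq).congr_deriv (by simp) |>.congr_of_eventuallyEq (.of_forall fun s => by simp)
  | mul_X p i hp =>
    fin_cases i
    · exact (hp.mul (hasDerivAt_ofReal (hasDerivAt_id z.1))).congr_deriv
        (by simp [pderiv_X, add_comm, mul_comm]) |>.congr_of_eventuallyEq (.of_forall fun s => by simp)
    · simpa [mul_comm, pderiv_X] using hp.mul_const (z.2 : 𝕜)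

lemma hasDerivAt_polyFun_snd (p : MvPolynomial (Fin 2) 𝕜) (z : ℝ × ℝ) :
    HasDerivAt (fun s : ℝ => polyFun p (z.1, s)) (polyFun (pderiv 1 p) z) z.2 := by
  induction p using MvPolynomial.induction_on with
  | C a => simpa using hasDerivAt_const z.2 a
  | add p q hp hq =>
    exact (hp.add hq).congr_deriv (by simp) |>.congr_of_eventuallyEq (.of_forall fun s => by simp)
  | mul_X p i hp =>
    fin_cases i
    · simpa [mul_comm, pderiv_X] using hp.mul_const (z.1 : 𝕜)
    · exact (hp.mul (hasDerivAt_ofReal (hasDerivAt_id z.2))).congr_deriv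
        (by simp [pderiv_X, add_comm, mul_comm]) |>.congr_of_eventuallyEq (.of_forall fun s => by simp)

lemma dx_polyFun (p : MvPolynomial (Fin 2) 𝕜) : dx (polyFun p) = polyFun (pderiv 0 p) :=
  funext fun z => (hasDerivAt_polyFun_fst p z).deriv

lemma dy_polyFun (p : MvPolynomial (Fin 2) 𝕜) : dy (polyFun p) = polyFun (pderiv 1 p) :=
  funext fun z => (hasDerivAt_polyFun_snd p z).deriv

/-! ### Agreement of the divergence form and the explicit form of the operator. -/

lemma hasDerivAt_bdry₁_fst (z : ℝ × ℝ) :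
    HasDerivAt (fun s => bdry₁ (s, z.2)) (-6 * z.1) z.1 := by
  unfold bdry₁
  exact (((hasDerivAt_pow 2 z.1).const_mul 3).const_sub (1 + 2 * z.2)).congr_deriv (by norm_num; ring)

lemma hasDerivAt_bdry₁_snd (z : ℝ × ℝ) :
    HasDerivAt (fun s => bdry₁ (z.1, s)) 2 z.2 := by
  unfold bdry₁
  exact ((((hasDerivAt_id z.2).const_mul 2).const_add 1).sub_const (3 * z.1 ^ 2)).congr_deriv
    (by norm_num)

lemma hasDerivAt_bdry₂_fst (z : ℝ × ℝ) :
    HasDerivAt (fun s => bdry₂ (s, z.2)) (72 * z.1 ^ 2 - 12 * z.2 - 6) z.1 := by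
  unfold bdry₂
  exact (((((((hasDerivAt_pow 3 z.1).const_mul 24).sub_const (z.2 ^ 2)).sub
    (((hasDerivAt_id z.1).const_mul 12).mul_const z.2)).sub
    ((hasDerivAt_id z.1).const_mul 6)).sub_const (4 * z.2)).sub_const 1).congr_deriv
    (by norm_num; ring)

lemma hasDerivAt_bdry₂_snd (z : ℝ × ℝ) :
    HasDerivAt (fun s => bdry₂ (z.1, s)) (-2 * z.2 - 12 * z.1 - 4) z.2 := by
  unfold bdry₂
  exact (((((((hasDerivAt_pow 2 z.2).const_sub (24 * z.1 ^ 3))).sub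
    ((hasDerivAt_id z.2).const_mul (12 * z.1))).sub_const (6 * z.1)).sub
    ((hasDerivAt_id z.2).const_mul 4)).sub_const 1).congr_deriv
    (by norm_num)

lemma hasDerivAt_const_mul_rpow_mul_rpow {f g : ℝ → ℝ} {f' g' s : ℝ} (c α β : ℝ)
    (hf : HasDerivAt f f' s) (hg : HasDerivAt g g' s) (hf0 : 0 < f s) (hg0 : 0 < g s) :
    HasDerivAt (fun t => c * f t ^ α * g t ^ β)
      (c * f s ^ α * g s ^ β * (α * f' / f s + β * g' / g s)) s := by
  refine (((hf.rpow_const (p := α) (Or.inl hf0.ne')).const_mul c).mul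
    (hg.rpow_const (p := β) (Or.inl hg0.ne'))).congr_deriv ?_
  rw [Real.rpow_sub_one hf0.ne', Real.rpow_sub_one hg0.ne']
  ring

lemma weight_mul_weight_neg (α β : ℝ) {z : ℝ × ℝ} (hz : z ∈ regionInt) :
    weight (-α) (-β) z * weight α β z = 1 := by
  obtain ⟨h1, h2⟩ := hz
  have e : (2 * -α + -β) = -(2 * α + β) := by ring
  have e' : (-α + -β) = -(α + β) := by ring
  have hpi : 0 < 4 * Real.pi ^ 2 := by positivity
  unfold weight
  rw [e, e', Real.rpow_neg hpi.le, Real.rpow_neg (by norm_num : (0 : ℝ) ≤ 3), Real.rpow_neg h1.le,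
    Real.rpow_neg h2.le]
  have a1 := (Real.rpow_pos_of_pos hpi (α + β)).ne'
  have a2 := (Real.rpow_pos_of_pos (by norm_num : (0 : ℝ) < 3) (2 * α + β)).ne'
  have a3 := (Real.rpow_pos_of_pos h1 α).ne'
  have a4 := (Real.rpow_pos_of_pos h2 β).ne'
  field_simp

/-- With the three lemmas after it: each factor divides both components of `Λ` times its own
gradient. The cofactors found here are the `α`- and `β`-parts of `B₁` and `B₂`, up to sign. -/
lemma A_grad_bdry₁_fst (z : ℝ × ℝ) :
    A₁₁ z * (-6 * z.1) + A₁₂ z * 2 = bdry₁ z * (-12 * z.1 - 6) := by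
  simp only [A₁₁, A₁₂, bdry₁]; ring

lemma A_grad_bdry₁_snd (z : ℝ × ℝ) :
    A₁₂ z * (-6 * z.1) + A₂₂ z * 2 = bdry₁ z * (-36 * z.1 - 18 * z.2) := by
  simp only [A₁₂, A₂₂, bdry₁]; ring

lemma A_grad_bdry₂_fst (z : ℝ × ℝ) :
    A₁₁ z * (72 * z.1 ^ 2 - 12 * z.2 - 6) + A₁₂ z * (-2 * z.2 - 12 * z.1 - 4)
      = bdry₂ z * (-18 * z.1) := by
  simp only [A₁₁, A₁₂, bdry₂]; ring

lemma A_grad_bdry₂_snd (z : ℝ × ℝ) :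
    A₁₂ z * (72 * z.1 ^ 2 - 12 * z.2 - 6) + A₂₂ z * (-2 * z.2 - 12 * z.1 - 4)
      = bdry₂ z * (-18 - 36 * z.2) := by
  simp only [A₁₂, A₂₂, bdry₂]; ring

/-- The polynomial `A₁₁` as an element of the polynomial ring. -/
def polyA₁₁ (𝕜 : Type*) [RCLike 𝕜] : MvPolynomial (Fin 2) 𝕜 := -6 * X 0 ^ 2 + X 1 + 3 * X 0 + 2

/-- The polynomial `A₁₂` as an element of the polynomial ring. -/
def polyA₁₂ (𝕜 : Type*) [RCLike 𝕜] : MvPolynomial (Fin 2) 𝕜 :=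
  -9 * X 0 * X 1 + 18 * X 0 ^ 2 - 6 * X 1 - 3

/-- The polynomial `A₂₂` as an element of the polynomial ring. -/
def polyA₂₂ (𝕜 : Type*) [RCLike 𝕜] : MvPolynomial (Fin 2) 𝕜 :=
  -18 * X 1 ^ 2 + 108 * X 0 ^ 3 - 54 * X 0 * X 1 - 27 * X 0 - 9 * X 1

lemma polyFun_polyA₁₁ (z : ℝ × ℝ) : polyFun (polyA₁₁ 𝕜) z = (A₁₁ z : 𝕜) := by
  simp only [A₁₁]
  push_cast
  simp [polyFun, polyA₁₁]

lemma polyFun_polyA₁₂ (z : ℝ × ℝ) : polyFun (polyA₁₂ 𝕜) z = (A₁₂ z : 𝕜) := by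
  simp only [A₁₂]
  push_cast
  simp [polyFun, polyA₁₂]

lemma polyFun_polyA₂₂ (z : ℝ × ℝ) : polyFun (polyA₂₂ 𝕜) z = (A₂₂ z : 𝕜) := by
  simp only [A₂₂]
  push_cast
  simp [polyFun, polyA₂₂]

/-- The first component of the vector field `Λ ∇ p`. -/
def flux₁ (p : MvPolynomial (Fin 2) 𝕜) : MvPolynomial (Fin 2) 𝕜 :=
  polyA₁₁ 𝕜 * pderiv 0 p + polyA₁₂ 𝕜 * pderiv 1 p

/-- The second component of the vector field `Λ ∇ p`. -/
def flux₂ (p : MvPolynomial (Fin 2) 𝕜) : MvPolynomial (Fin 2) 𝕜 :=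
  polyA₁₂ 𝕜 * pderiv 0 p + polyA₂₂ 𝕜 * pderiv 1 p

lemma pderiv_one_zero (p : MvPolynomial (Fin 2) 𝕜) :
    pderiv 1 (pderiv 0 p) = pderiv 0 (pderiv 1 p) := by
  induction p using MvPolynomial.induction_on with
  | C a => simp
  | add p q hp hq => simp [hp, hq]
  | mul_X p i hp =>
    fin_cases i <;> simp [hp, pderiv_X, add_comm]

/-- `L` in terms of the divergence of `Λ ∇ p`. -/
lemma jacobiOpPoly_eq (α β : ℝ) (p : MvPolynomial (Fin 2) 𝕜) :
    jacobiOpPoly α β p = -(pderiv 0 (flux₁ p) + pderiv 1 (flux₂ p))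
      + C (α : 𝕜) * ((12 * X 0 + 6) * pderiv 0 p + (36 * X 0 + 18 * X 1) * pderiv 1 p)
      + C (β : 𝕜) * (18 * X 0 * pderiv 0 p + (18 + 36 * X 1) * pderiv 1 p) := by
  have h : ∀ (i : Fin 2) (n : ℕ) [n.AtLeastTwo],
      pderiv i (OfNat.ofNat n : MvPolynomial (Fin 2) 𝕜) = 0 := fun i n _ => by
    have : (OfNat.ofNat n : MvPolynomial (Fin 2) 𝕜) = C (OfNat.ofNat n) := (map_ofNat C n).symm
    rw [this]
    exact pderiv_C
  simp only [jacobiOpPoly, flux₁, flux₂, polyA₁₁, polyA₁₂, polyA₂₂, map_add, map_sub, map_neg,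
    Derivation.leibniz, Derivation.leibniz_pow, pderiv_X_self, smul_eq_mul, h, pderiv_one_zero,
    pderiv_X_of_ne (show (1 : Fin 2) ≠ 0 by decide), pderiv_X_of_ne (show (0 : Fin 2) ≠ 1 by decide)]
  simp only [nsmul_eq_mul, Nat.cast_ofNat]
  ring

/-- The pointwise algebra behind `jacobiOp_polyFun`: the product rule gives logarithmic derivatives
with denominators `b1` and `b2`, and `g1`–`g4` cancel them. `D1`, `D2` stand for the derivatives of
the flux. -/
lemma divergence_identity {W' W D1 D2 p1 p2 b1 b2 a11 a12 a22 x y a b : 𝕜} (n1 : b1 ≠ 0)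
    (n2 : b2 ≠ 0) (hw : W' * W = 1)
    (g1 : a11 * (-6 * x) + a12 * 2 = b1 * (-12 * x - 6))
    (g2 : a12 * (-6 * x) + a22 * 2 = b1 * (-36 * x - 18 * y))
    (g3 : a11 * (72 * x ^ 2 - 12 * y - 6) + a12 * (-2 * y - 12 * x - 4) = b2 * (-18 * x))
    (g4 : a12 * (72 * x ^ 2 - 12 * y - 6) + a22 * (-2 * y - 12 * x - 4) = b2 * (-18 - 36 * y)) :
    -(W' * ((W * (a * (-6 * x) / b1 + b * (72 * x ^ 2 - 12 * y - 6) / b2) * (a11 * p1 + a12 * p2)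
        + W * D1)
      + (W * (a * 2 / b1 + b * (-2 * y - 12 * x - 4) / b2) * (a12 * p1 + a22 * p2) + W * D2)))
    = -(D1 + D2) + a * ((12 * x + 6) * p1 + (36 * x + 18 * y) * p2)
      + b * (18 * x * p1 + (18 + 36 * y) * p2) := by
  have k1 : (a * (-6 * x) / b1 + b * (72 * x ^ 2 - 12 * y - 6) / b2) * (a11 * p1 + a12 * p2)
      + (a * 2 / b1 + b * (-2 * y - 12 * x - 4) / b2) * (a12 * p1 + a22 * p2)
      = a * ((-12 * x - 6) * p1 + (-36 * x - 18 * y) * p2)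
        + b * ((-18 * x) * p1 + (-18 - 36 * y) * p2) := by
    field_simp
    linear_combination a * b2 * p1 * g1 + a * b2 * p2 * g2 + b * b1 * p1 * g3 + b * b1 * p2 * g4
  linear_combination (-(W' * W)) * k1 - (D1 + D2 + (a * ((-12 * x - 6) * p1
    + (-36 * x - 18 * y) * p2) + b * ((-18 * x) * p1 + (-18 - 36 * y) * p2))) * hw

lemma jacobiOp_polyFun (α β : ℝ) (p : MvPolynomial (Fin 2) 𝕜) {z : ℝ × ℝ} (hz : z ∈ regionInt) :
    jacobiOp α β (polyFun p) z = polyFun (jacobiOpPoly α β p) z := by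
  obtain ⟨h1, h2⟩ := id hz
  have e1 : (fun u : ℝ × ℝ => (weight α β u : 𝕜) * ((A₁₁ u : 𝕜) * dx (polyFun p) u
      + (A₁₂ u : 𝕜) * dy (polyFun p) u)) = fun u => (weight α β u : 𝕜) * polyFun (flux₁ p) u := by
    funext u
    simp [flux₁, dx_polyFun, dy_polyFun, polyFun_polyA₁₁, polyFun_polyA₁₂]
  have e2 : (fun u : ℝ × ℝ => (weight α β u : 𝕜) * ((A₁₂ u : 𝕜) * dx (polyFun p) u
      + (A₂₂ u : 𝕜) * dy (polyFun p) u)) = fun u => (weight α β u : 𝕜) * polyFun (flux₂ p) u := by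
    funext u
    simp [flux₂, dx_polyFun, dy_polyFun, polyFun_polyA₂₂, polyFun_polyA₁₂]
  have d1 := (hasDerivAt_ofReal (𝕜 := 𝕜) (hasDerivAt_const_mul_rpow_mul_rpow
    ((4 * Real.pi ^ 2) ^ (α + β) / (3 : ℝ) ^ (2 * α + β)) α β (hasDerivAt_bdry₁_fst z)
    (hasDerivAt_bdry₂_fst z) h1 h2)).mul (hasDerivAt_polyFun_fst (flux₁ p) z)
  have d2 := (hasDerivAt_ofReal (𝕜 := 𝕜) (hasDerivAt_const_mul_rpow_mul_rpow
    ((4 * Real.pi ^ 2) ^ (α + β) / (3 : ℝ) ^ (2 * α + β)) α β (hasDerivAt_bdry₁_snd z)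
    (hasDerivAt_bdry₂_snd z) h1 h2)).mul (hasDerivAt_polyFun_snd (flux₂ p) z)
  have d1' := d1.deriv
  have d2' := d2.deriv
  rw [jacobiOp, e1, e2]
  unfold dx dy
  change -((weight (-α) (-β) z : 𝕜) * (deriv (fun s => ((weight α β (s, z.2) : ℝ) : 𝕜) * _) z.1
    + deriv (fun s => ((weight α β (z.1, s) : ℝ) : 𝕜) * _) z.2)) = _
  erw [d1', d2']
  change -((weight (-α) (-β) z : 𝕜) * ((((weight α β z * (α * (-6 * z.1) / bdry₁ z
    + β * (72 * z.1 ^ 2 - 12 * z.2 - 6) / bdry₂ z) : ℝ) : 𝕜) * polyFun (flux₁ p) z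
    + (weight α β z : 𝕜) * polyFun (pderiv 0 (flux₁ p)) z)
    + (((weight α β z * (α * 2 / bdry₁ z
    + β * (-2 * z.2 - 12 * z.1 - 4) / bdry₂ z) : ℝ) : 𝕜) * polyFun (flux₂ p) z
    + (weight α β z : 𝕜) * polyFun (pderiv 1 (flux₂ p)) z))) = _
  have hw : (weight (-α) (-β) z : 𝕜) * (weight α β z : 𝕜) = 1 := by
    exact_mod_cast congrArg (RCLike.ofReal (K := 𝕜)) (weight_mul_weight_neg α β hz)
  have g1 := congrArg (RCLike.ofReal (K := 𝕜)) (A_grad_bdry₁_fst z)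
  have g2 := congrArg (RCLike.ofReal (K := 𝕜)) (A_grad_bdry₁_snd z)
  have g3 := congrArg (RCLike.ofReal (K := 𝕜)) (A_grad_bdry₂_fst z)
  have g4 := congrArg (RCLike.ofReal (K := 𝕜)) (A_grad_bdry₂_snd z)
  have n1 : (bdry₁ z : 𝕜) ≠ 0 := by exact_mod_cast h1.ne'
  have n2 : (bdry₂ z : 𝕜) ≠ 0 := by exact_mod_cast h2.ne'
  rw [jacobiOpPoly_eq]
  have f1 : polyFun (flux₁ p) z = (A₁₁ z : 𝕜) * polyFun (pderiv 0 p) z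
      + (A₁₂ z : 𝕜) * polyFun (pderiv 1 p) z := by
    simp [flux₁, polyFun_polyA₁₁, polyFun_polyA₁₂]
  have f2 : polyFun (flux₂ p) z = (A₁₂ z : 𝕜) * polyFun (pderiv 0 p) z
      + (A₂₂ z : 𝕜) * polyFun (pderiv 1 p) z := by
    simp [flux₂, polyFun_polyA₂₂, polyFun_polyA₁₂]
  have e : polyFun (-(pderiv 0 (flux₁ p) + pderiv 1 (flux₂ p))
      + C (α : 𝕜) * ((12 * X 0 + 6) * pderiv 0 p + (36 * X 0 + 18 * X 1) * pderiv 1 p)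
      + C (β : 𝕜) * (18 * X 0 * pderiv 0 p + (18 + 36 * X 1) * pderiv 1 p)) z
      = -(polyFun (pderiv 0 (flux₁ p)) z + polyFun (pderiv 1 (flux₂ p)) z)
      + α * ((12 * z.1 + 6) * polyFun (pderiv 0 p) z + (36 * z.1 + 18 * z.2) *
          polyFun (pderiv 1 p) z)
      + β * (18 * z.1 * polyFun (pderiv 0 p) z + (18 + 36 * z.2) * polyFun (pderiv 1 p) z) := by
    simp [polyFun]
  rw [e, f1, f2]
  push_cast at g1 g2 g3 g4 ⊢
  exact divergence_identity n1 n2 hw g1 g2 g3 g4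

end

/-! ### Geometry of the region. -/

lemma bdry₁_param (r v : ℝ) : bdry₁ ((3 * r ^ 2 - 1) / 2, v - (9 * r ^ 2 - 1))
    = 2 * (v - 9 / 8 * (3 * r ^ 4 + 6 * r ^ 2 - 1)) := by
  simp only [bdry₁]; ring

/-- Since `f₂ = 3(2x+1)³ - (y+6x+2)²`, putting `2x + 1 = 3r²` and `v = y + 6x + 2` makes it a
difference of squares, so the roots in `y` of both factors become polynomials in `r`. -/
lemma bdry₂_param (r v : ℝ) : bdry₂ ((3 * r ^ 2 - 1) / 2, v - (9 * r ^ 2 - 1))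
    = (9 * r ^ 3 - v) * (v + 9 * r ^ 3) := by
  simp only [bdry₂]; ring

lemma neg_half_le_of_bdry₂_nonneg {z : ℝ × ℝ} (h : 0 ≤ bdry₂ z) : -(1 / 2) ≤ z.1 := by
  have e : bdry₂ z = 3 * (2 * z.1 + 1) ^ 3 - (z.2 + 6 * z.1 + 2) ^ 2 := by
    simp only [bdry₂]; ring
  have h3 : 0 ≤ (2 * z.1 + 1) ^ 3 := by nlinarith [sq_nonneg (z.2 + 6 * z.1 + 2)]
  have : 0 ≤ 2 * z.1 + 1 := by
    by_contra hn
    push Not at hn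
    have := Odd.pow_neg (n := 3) (by decide) hn
    linarith
  linarith

/-- Every point with `bdry₂ ≥ 0` is `((3r² - 1)/2, v - (9r² - 1))` with `r ≥ 0`. -/
lemma exists_param {z : ℝ × ℝ} (h : -(1 / 2) ≤ z.1) :
    ∃ r : ℝ, 0 ≤ r ∧ ∃ v, z = ((3 * r ^ 2 - 1) / 2, v - (9 * r ^ 2 - 1)) := by
  refine ⟨√((2 * z.1 + 1) / 3), Real.sqrt_nonneg _, z.2 + (6 * z.1 + 2), ?_⟩
  rw [Real.sq_sqrt (by linarith)]
  ext <;> simp <;> ring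

lemma region_bounds {z : ℝ × ℝ} (hz : z ∈ region) :
    -(1 / 2) ≤ z.1 ∧ z.1 ≤ 1 ∧ -20 ≤ z.2 ∧ z.2 ≤ 20 := by
  obtain ⟨h1, h2⟩ := hz
  have hx := neg_half_le_of_bdry₂_nonneg h2
  obtain ⟨r, hr, v, rfl⟩ := exists_param hx
  rw [bdry₁_param] at h1
  rw [bdry₂_param] at h2
  have hr3 : 0 ≤ r ^ 3 := by positivity
  have hv : |v| ≤ 9 * r ^ 3 := by
    apply abs_le_of_sq_le_sq _ (by positivity)
    nlinarith
  have hv' := abs_le.1 hv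
  have hr1 : r ≤ 1 := by
    by_contra hn
    push Not at hn
    -- The two inequalities force `9/8 (3r⁴ + 6r² - 1) ≤ v ≤ 9r³`, and the lower bound minus the
    -- upper one is `9/8 (r - 1)³(3r + 1)`.
    have : 0 < (r - 1) ^ 3 * (3 * r + 1) := by
      have : 0 < r - 1 := by linarith
      positivity
    nlinarith
  have hr31 : r ^ 3 ≤ 1 := pow_le_one₀ hr hr1
  have hr21 : r ^ 2 ≤ 1 := pow_le_one₀ hr hr1
  refine ⟨hx, ?_, ?_, ?_⟩ <;> dsimp only <;> nlinarith [sq_nonneg r]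

lemma continuous_bdry₁ : Continuous bdry₁ := by unfold bdry₁; fun_prop

lemma continuous_bdry₂ : Continuous bdry₂ := by unfold bdry₂; fun_prop

lemma isClosed_region : IsClosed region :=
  (isClosed_le continuous_const continuous_bdry₁).inter
    (isClosed_le continuous_const continuous_bdry₂)

lemma isOpen_regionInt : IsOpen regionInt :=
  (isOpen_lt continuous_const continuous_bdry₁).inter
    (isOpen_lt continuous_const continuous_bdry₂)

lemma regionInt_subset_region : regionInt ⊆ region := fun _ h => ⟨h.1.le, h.2.le⟩

lemma isCompact_region : IsCompact region := by
  refine (isCompact_Icc.prod isCompact_Icc : IsCompact (Set.Icc (-(1 / 2) : ℝ) 1 ×ˢ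
    Set.Icc (-20 : ℝ) 20)).of_isClosed_subset isClosed_region fun z hz => ?_
  obtain ⟨a, b, c, d⟩ := region_bounds hz
  exact ⟨⟨a, b⟩, ⟨c, d⟩⟩

lemma regionInt_nonempty : regionInt.Nonempty :=
  ⟨(0, -(2 / 5)), by constructor <;> norm_num [bdry₁, bdry₂]⟩

lemma volume_region_diff_regionInt : volume (region \ regionInt) = 0 := by
  have hm : MeasurableSet (region \ regionInt) :=
    isClosed_region.measurableSet.diff isOpen_regionInt.measurableSet
  rw [Measure.volume_eq_prod, Measure.measure_prod_null hm]
  refine .of_forall fun x => ?_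
  by_cases hx : -(1 / 2) ≤ x
  · obtain ⟨r, hr, v, hv⟩ := exists_param (z := (x, 0)) hx
    obtain ⟨rfl, -⟩ := Prod.ext_iff.1 hv
    -- A vertical slice meets the boundary only at the root of `f₁` and the two roots of `f₂`, at
    -- most three points.
    refine (Set.Finite.subset (s := {9 / 8 * (3 * r ^ 4 + 6 * r ^ 2 - 1) - (9 * r ^ 2 - 1),
      9 * r ^ 3 - (9 * r ^ 2 - 1), -(9 * r ^ 3) - (9 * r ^ 2 - 1)}) (by simp) ?_).measure_zero _
    intro y hy
    obtain ⟨⟨h1, h2⟩, h3⟩ := hy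
    have e : y = (y + (9 * r ^ 2 - 1)) - (9 * r ^ 2 - 1) := by ring
    simp only [Set.mem_insert_iff, Set.mem_singleton_iff]
    by_contra hn
    push Not at hn
    obtain ⟨n1, n2, n3⟩ := hn
    apply h3
    rw [e] at h1 h2 ⊢
    refine ⟨lt_of_le_of_ne h1 ?_, lt_of_le_of_ne h2 ?_⟩
    · rw [bdry₁_param]
      intro h
      apply n1
      linarith
    · rw [bdry₂_param]
      intro h
      rcases mul_eq_zero.1 h.symm with h | h
      · apply n2; linarith
      · apply n3; linarith
  · have : Prod.mk x ⁻¹' (region \ regionInt) = ∅ := by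
      ext y
      simp only [Set.mem_preimage, Set.mem_empty_iff_false, iff_false]
      exact fun hy => hx (neg_half_le_of_bdry₂_nonneg (z := (x, y)) hy.1.2)
    simp [this]

lemma region_ae_eq_regionInt : region =ᵐ[volume] regionInt := by
  rw [ae_eq_set]
  exact ⟨volume_region_diff_regionInt, by rw [Set.sdiff_eq_empty.2 regionInt_subset_region]; simp⟩

lemma restrict_region : (volume : Measure (ℝ × ℝ)).restrict region = volume.restrict regionInt :=
  Measure.restrict_congr_set region_ae_eq_regionInt

/-! ### Integrability of `(f₁ f₂)^{-1/2}`, slice by slice. -/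

lemma inv_sqrt_eq_rpow {y : ℝ} (hy : 0 ≤ y) : (√y)⁻¹ = y ^ (-(1 / 2) : ℝ) := by
  rw [Real.rpow_neg hy, Real.sqrt_eq_rpow]

lemma lintegral_Ioo_inv_sqrt {L : ℝ} (hL : 0 ≤ L) :
    ∫⁻ y in Set.Ioo 0 L, ENNReal.ofReal (√y)⁻¹ = ENNReal.ofReal (2 * √L) := by
  have hi : IntervalIntegrable (fun y : ℝ => y ^ (-(1 / 2) : ℝ)) volume 0 L :=
    intervalIntegral.intervalIntegrable_rpow' (by norm_num)
  have hI := integral_rpow (a := 0) (b := L) (r := (-(1 / 2) : ℝ)) (Or.inl (by norm_num))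
  rw [intervalIntegrable_iff_integrableOn_Ioo_of_le hL] at hi
  rw [intervalIntegral.integral_of_le hL, MeasureTheory.integral_Ioc_eq_integral_Ioo] at hI
  rw [setLIntegral_congr_fun (g := fun y => ENNReal.ofReal (y ^ (-(1 / 2) : ℝ))) measurableSet_Ioo
    fun y hy => by simp only [inv_sqrt_eq_rpow hy.1.le],
    ← ofReal_integral_eq_lintegral_ofReal hi, hI]
  · congr 1
    rw [Real.sqrt_eq_rpow]
    norm_num
    ring
  · filter_upwards [ae_restrict_mem measurableSet_Ioo] with y hy
    exact Real.rpow_nonneg hy.1.le _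

lemma lintegral_Ioo_inv_sqrt_sub_left {p q : ℝ} (h : p ≤ q) :
    ∫⁻ y in Set.Ioo p q, ENNReal.ofReal (√(y - p))⁻¹ = ENNReal.ofReal (2 * √(q - p)) := by
  rw [← lintegral_Ioo_inv_sqrt (sub_nonneg.2 h), ← lintegral_indicator measurableSet_Ioo,
    ← lintegral_indicator measurableSet_Ioo,
    ← lintegral_sub_right_eq_self ((Set.Ioo 0 (q - p)).indicator _) p]
  congr 1
  funext y
  simp [Set.indicator_apply]

lemma lintegral_Ioo_inv_sqrt_sub_right {p q : ℝ} (h : p ≤ q) :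
    ∫⁻ y in Set.Ioo p q, ENNReal.ofReal (√(q - y))⁻¹ = ENNReal.ofReal (2 * √(q - p)) := by
  rw [← lintegral_Ioo_inv_sqrt (sub_nonneg.2 h), ← lintegral_indicator measurableSet_Ioo,
    ← lintegral_indicator measurableSet_Ioo,
    ← lintegral_sub_left_eq_self ((Set.Ioo 0 (q - p)).indicator _) q]
  congr 1
  funext y
  simp [Set.indicator_apply, and_comm]

/-- After clearing denominators this is `c ≤ a + b`. It acts as partial fractions for inverse square
roots: it separates singularities at opposite ends of an interval. -/
lemma inv_mul_inv_le_of_sq_add_sq {a b c : ℝ} (ha : 0 < a) (hb : 0 < b) (hc : 0 < c)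
    (h : c ^ 2 = a ^ 2 + b ^ 2) : a⁻¹ * b⁻¹ ≤ c⁻¹ * (a⁻¹ + b⁻¹) := by
  have hle : c ≤ a + b := by
    apply (sq_le_sq₀ hc.le (by positivity)).1
    nlinarith [mul_pos ha hb]
  rw [← sub_nonneg]
  have : c⁻¹ * (a⁻¹ + b⁻¹) - a⁻¹ * b⁻¹ = (a + b - c) / (a * b * c) := by
    field_simp
    ring
  rw [this]
  exact div_nonneg (by linarith) (by positivity)

/-- The larger of `a` and `b` is at least `c`. This is the version for two singular points on the
same side of the variable. -/
lemma inv_mul_inv_le_of_sq_sub {a b c m : ℝ} (ha : 0 < a) (hb : 0 < b) (hc : 0 < c)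
    (hm : m = min a b) (h : c ^ 2 = |a ^ 2 - b ^ 2|) : a⁻¹ * b⁻¹ ≤ c⁻¹ * m⁻¹ := by
  rcases le_total a b with hab | hab
  · have : c ≤ b := by
      apply (sq_le_sq₀ hc.le hb.le).1
      rw [h, abs_of_nonpos (by nlinarith)]
      nlinarith
    rw [hm, min_eq_left hab, mul_comm]
    gcongr
  · have : c ≤ a := by
      apply (sq_le_sq₀ hc.le ha.le).1
      rw [h, abs_of_nonneg (by nlinarith)]
      nlinarith
    rw [hm, min_eq_right hab]
    gcongr

/-- Here `p` is the root of `f₁` and `s < q` are the roots of `f₂` on a slice. Splitting first at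
`q, s`, then at `p, q` and `p, s`, leaves terms with one singularity in `y` each. -/
lemma inv_sqrt_cubic_le {p q s y : ℝ} (hps : p ≠ s) (hy : y ∈ Set.Ioo (max p s) q) :
    (√(2 * (y - p)))⁻¹ * (√((q - y) * (y - s)))⁻¹ ≤
      (√(q - s))⁻¹ * ((√(q - p))⁻¹ * ((√(y - p))⁻¹ + (√(q - y))⁻¹)
        + (√|p - s|)⁻¹ * (√(y - max p s))⁻¹) := by
  obtain ⟨hm, hq⟩ := hy
  have hp : p < y := (le_max_left _ _).trans_lt hm
  have hs : s < y := (le_max_right _ _).trans_lt hm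
  have A0 : 0 < √(y - p) := Real.sqrt_pos.2 (by linarith)
  have B0 : 0 < √(q - y) := Real.sqrt_pos.2 (by linarith)
  have S0 : 0 < √(y - s) := Real.sqrt_pos.2 (by linarith)
  have D0 : 0 < √(q - s) := Real.sqrt_pos.2 (by linarith)
  have E0 : 0 < √(q - p) := Real.sqrt_pos.2 (by linarith)
  have d0 : 0 < √|p - s| := Real.sqrt_pos.2 (abs_pos.2 (sub_ne_zero.2 hps))
  have A2 := Real.sq_sqrt (show 0 ≤ y - p by linarith)
  have B2 := Real.sq_sqrt (show 0 ≤ q - y by linarith)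
  have S2 := Real.sq_sqrt (show 0 ≤ y - s by linarith)
  have D2 := Real.sq_sqrt (show 0 ≤ q - s by linarith)
  have E2 := Real.sq_sqrt (show 0 ≤ q - p by linarith)
  have d2 := Real.sq_sqrt (abs_nonneg (p - s))
  have hmin : √(y - max p s) = min √(y - p) √(y - s) := by
    rcases le_total p s with h | h
    · rw [max_eq_right h, min_eq_right (Real.sqrt_le_sqrt (by linarith))]
    · rw [max_eq_left h, min_eq_left (Real.sqrt_le_sqrt (by linarith))]
  have h1 : (√(2 * (y - p)))⁻¹ ≤ (√(y - p))⁻¹ :=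
    inv_anti₀ A0 (Real.sqrt_le_sqrt (by linarith))
  rw [Real.sqrt_mul (by linarith : 0 ≤ q - y), mul_inv]
  have k1 := inv_mul_inv_le_of_sq_add_sq B0 S0 D0 (by rw [D2, B2, S2]; ring)
  have k2 := inv_mul_inv_le_of_sq_add_sq A0 B0 E0 (by rw [E2, A2, B2]; ring)
  have k3 := inv_mul_inv_le_of_sq_sub A0 S0 d0 hmin (by
    rw [d2, A2, S2, abs_sub_comm]; congr 1; ring)
  calc (√(2 * (y - p)))⁻¹ * ((√(q - y))⁻¹ * (√(y - s))⁻¹)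
      ≤ (√(y - p))⁻¹ * ((√(q - s))⁻¹ * ((√(q - y))⁻¹ + (√(y - s))⁻¹)) := by gcongr
    _ = (√(q - s))⁻¹ * ((√(y - p))⁻¹ * (√(q - y))⁻¹ + (√(y - p))⁻¹ * (√(y - s))⁻¹) := by ring
    _ ≤ _ := by gcongr

/-- The integral over an interval of length `q - p` produces a factor `√(q - p)` that cancels the
one in the denominator, so the bound stays finite as `p` and `q` merge, which happens at the cusp `x
= 1`. -/
lemma lintegral_inv_sqrt_cubic_le {p q s : ℝ} (hps : p ≠ s) (hsq : s < q) :
    ∫⁻ y in Set.Ioo (max p s) q,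
      ENNReal.ofReal ((√(2 * (y - p)))⁻¹ * (√((q - y) * (y - s)))⁻¹) ≤
      ENNReal.ofReal (4 * (√(q - s))⁻¹ + 2 * (√|p - s|)⁻¹) := by
  rcases le_or_gt q p with hqp | hpq
  · rw [Set.Ioo_eq_empty (by simp [hqp])]
    simp
  have hmq : max p s < q := max_lt hpq hsq
  have D0 : 0 < √(q - s) := Real.sqrt_pos.2 (by linarith)
  have E0 : 0 < √(q - p) := Real.sqrt_pos.2 (by linarith)
  have hle : √(q - max p s) ≤ √(q - s) := Real.sqrt_le_sqrt (by linarith [le_max_right p s])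
  have hsub : Set.Ioo (max p s) q ⊆ Set.Ioo p q := Set.Ioo_subset_Ioo_left (le_max_left _ _)
  have i1 : ∫⁻ y in Set.Ioo (max p s) q, ENNReal.ofReal (√(y - p))⁻¹
      ≤ ENNReal.ofReal (2 * √(q - p)) :=
    (lintegral_mono_set hsub).trans_eq (lintegral_Ioo_inv_sqrt_sub_left hpq.le)
  have i2 : ∫⁻ y in Set.Ioo (max p s) q, ENNReal.ofReal (√(q - y))⁻¹
      ≤ ENNReal.ofReal (2 * √(q - p)) :=
    (lintegral_mono_set hsub).trans_eq (lintegral_Ioo_inv_sqrt_sub_right hpq.le)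
  have i3 := lintegral_Ioo_inv_sqrt_sub_left hmq.le
  calc _ ≤ ∫⁻ y in Set.Ioo (max p s) q, ENNReal.ofReal (√(q - s))⁻¹ *
        (ENNReal.ofReal (√(q - p))⁻¹ * (ENNReal.ofReal (√(y - p))⁻¹ + ENNReal.ofReal (√(q - y))⁻¹)
        + ENNReal.ofReal (√|p - s|)⁻¹ * ENNReal.ofReal (√(y - max p s))⁻¹) := by
        refine setLIntegral_mono' measurableSet_Ioo fun y hy => ?_
        rw [← ENNReal.ofReal_add (by positivity) (by positivity),
          ← ENNReal.ofReal_mul (by positivity), ← ENNReal.ofReal_mul (by positivity),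
          ← ENNReal.ofReal_add (by positivity) (by positivity),
          ← ENNReal.ofReal_mul (by positivity)]
        exact ENNReal.ofReal_le_ofReal (inv_sqrt_cubic_le hps hy)
    _ ≤ ENNReal.ofReal (√(q - s))⁻¹ * (ENNReal.ofReal (√(q - p))⁻¹ *
        (ENNReal.ofReal (2 * √(q - p)) + ENNReal.ofReal (2 * √(q - p)))
        + ENNReal.ofReal (√|p - s|)⁻¹ * ENNReal.ofReal (2 * √(q - max p s))) := by
        rw [lintegral_const_mul _ (by fun_prop), lintegral_add_left (by fun_prop),
          lintegral_const_mul _ (by fun_prop), lintegral_add_left (by fun_prop),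
          lintegral_const_mul _ (by fun_prop), i3]
        gcongr
    _ ≤ _ := by
        rw [← ENNReal.ofReal_add (by positivity) (by positivity),
          ← ENNReal.ofReal_mul (by positivity), ← ENNReal.ofReal_mul (by positivity),
          ← ENNReal.ofReal_add (by positivity) (by positivity),
          ← ENNReal.ofReal_mul (by positivity)]
        apply ENNReal.ofReal_le_ofReal
        have e : (√(q - s))⁻¹ * ((√(q - p))⁻¹ * (2 * √(q - p) + 2 * √(q - p))
            + (√|p - s|)⁻¹ * (2 * √(q - max p s)))
            = 4 * (√(q - s))⁻¹ + 2 * (√|p - s|)⁻¹ * ((√(q - s))⁻¹ * √(q - max p s)) := by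
          field_simp
          ring
        rw [e]
        have : (√(q - s))⁻¹ * √(q - max p s) ≤ 1 := by
          rw [inv_mul_le_iff₀ D0]; linarith
        have := mul_le_mul_of_nonneg_left this (show 0 ≤ 2 * (√|p - s|)⁻¹ by positivity)
        linarith

/-- The bound for the integral of `(f₁ f₂)^{-1/2}` over the slice with first coordinate `x`. -/
def sliceBound (x : ℝ) : ℝ := 4 * (x + 1 / 2) ^ (-(3 / 4) : ℝ) + 2 * |x + 1 / 3| ^ (-(1 / 2) : ℝ)

/-- For a negative base, `Real.rpow` carries the factor `cos (-π/2) = 0`, so one summand always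
vanishes; at `0` all the powers are `0`. This reduces the absolute value to ordinary powers. -/
lemma abs_rpow_neg_half (x : ℝ) :
    |x| ^ (-(1 / 2) : ℝ) = x ^ (-(1 / 2) : ℝ) + (-x) ^ (-(1 / 2) : ℝ) := by
  have hc : Real.cos (-(1 / 2) * Real.pi) = 0 := by
    rw [← Real.cos_neg, ← Real.cos_pi_div_two]; congr 1; ring
  rcases lt_trichotomy x 0 with h | rfl | h
  · rw [abs_of_neg h, Real.rpow_def_of_neg h, hc]; simp
  · simp
  · rw [abs_of_pos h, Real.rpow_def_of_neg (neg_neg_of_pos h), hc]; simp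

lemma integrableOn_sliceBound : IntegrableOn sliceBound (Set.Ioo (-(1 / 2)) 1) := by
  rw [← intervalIntegrable_iff_integrableOn_Ioo_of_le (by norm_num)]
  unfold sliceBound
  have h1 (c r a b : ℝ) (hr : -1 < r) :
      IntervalIntegrable (fun x : ℝ => (x + c) ^ r) volume a b := by
    simpa using (intervalIntegral.intervalIntegrable_rpow' (a := a + c) (b := b + c) hr).comp_add_right c
  have h2 : IntervalIntegrable (fun x : ℝ => (-(x + 1 / 3)) ^ (-(1 / 2) : ℝ)) volume (-(1 / 2)) 1 := by
    have := (intervalIntegral.intervalIntegrable_rpow' (a := -(-(1 / 2) + 1 / 3)) (b := -(1 + 1 / 3))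
      (r := -(1 / 2)) (by norm_num)).comp_sub_left (-(1 / 3))
    norm_num at this ⊢
    refine this.congr ?_
    intro x _; simp only; congr 1
  simp_rw [abs_rpow_neg_half]
  exact ((h1 _ _ _ _ (by norm_num)).const_mul 4).add
    (((h1 _ _ _ _ (by norm_num)).add h2).const_mul 2)

/-- The excluded slice `x = -1/3` is `r = 1/3`, where the root of `f₁` meets the lower root of `f₂`.
-/
lemma lintegral_slice_le {x : ℝ} (hx : x ∈ Set.Ioo (-(1 / 2) : ℝ) 1) (hx' : x ≠ -(1 / 3)) :
    ∫⁻ y, regionInt.indicator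
      (fun z => ENNReal.ofReal ((√(bdry₁ z))⁻¹ * (√(bdry₂ z))⁻¹)) (x, y)
      ≤ ENNReal.ofReal (sliceBound x) := by
  obtain ⟨r, hr, v, hv⟩ := exists_param (z := (x, 0)) hx.1.le
  obtain ⟨hxr, -⟩ := Prod.ext_iff.1 hv
  simp only at hxr
  have hr0 : 0 < r := by
    rcases hr.eq_or_lt with rfl | h
    · exfalso; have := hx.1; rw [hxr] at this; norm_num at this
    · exact h
  set k := 9 * r ^ 2 - 1 with hk
  set p := 9 / 8 * (3 * r ^ 4 + 6 * r ^ 2 - 1) - k with hp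
  set q := 9 * r ^ 3 - k with hq
  set s := -(9 * r ^ 3) - k with hs
  have e1 (y : ℝ) : bdry₁ (x, y) = 2 * (y - p) := by
    have := bdry₁_param r (y + k)
    rw [← hk, ← hxr, add_sub_cancel_right] at this
    rw [this, hp]; ring
  have e2 (y : ℝ) : bdry₂ (x, y) = (q - y) * (y - s) := by
    have := bdry₂_param r (y + k)
    rw [← hk, ← hxr, add_sub_cancel_right] at this
    rw [this, hq, hs]; ring
  have hqs : q - s = 18 * r ^ 3 := by rw [hq, hs]; ring
  have hps : p - s = 9 / 8 * (r + 1) ^ 3 * (3 * r - 1) := by rw [hp, hs]; ring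
  have hr3 : 0 < r ^ 3 := by positivity
  have hx3 : x + 1 / 3 = (3 * r - 1) * (3 * r + 1) / 6 := by rw [hxr]; ring
  have h3r : 3 * r - 1 ≠ 0 := by
    intro h
    apply hx'
    rw [h] at hx3
    linarith
  have hne : p ≠ s := by
    rw [← sub_ne_zero, hps]
    positivity
  have hsub : ∀ y, regionInt.indicator
      (fun z => ENNReal.ofReal ((√(bdry₁ z))⁻¹ * (√(bdry₂ z))⁻¹)) (x, y)
      ≤ (Set.Ioo (max p s) q).indicator (fun y =>
        ENNReal.ofReal ((√(2 * (y - p)))⁻¹ * (√((q - y) * (y - s)))⁻¹)) y := by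
    intro y
    by_cases hy : (x, y) ∈ regionInt
    · have hy' : y ∈ Set.Ioo (max p s) q := by
        obtain ⟨g1, g2⟩ := hy
        rw [e1] at g1
        rw [e2] at g2
        rcases pos_and_pos_or_neg_and_neg_of_mul_pos g2 with ⟨a, b⟩ | ⟨a, b⟩
        · exact ⟨max_lt (by linarith) (by linarith), by linarith⟩
        · linarith
      rw [Set.indicator_of_mem hy, Set.indicator_of_mem hy', e1, e2]
    · rw [Set.indicator_of_notMem hy]
      exact zero_le
  refine (lintegral_mono hsub).trans ?_
  rw [lintegral_indicator measurableSet_Ioo]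
  refine (lintegral_inv_sqrt_cubic_le hne (by linarith)).trans (ENNReal.ofReal_le_ofReal ?_)
  unfold sliceBound
  have ht : 0 < x + 1 / 2 := by linarith [hx.1]
  have hxabs : 0 < |x + 1 / 3| := by
    rw [abs_pos]; intro h; apply hx'; linarith
  -- From `x + 1/2 = 3r²/2` one gets `(x + 1/2)^{3/2} = (3/2)^{3/2} r³ ≤ 8 r³`, below `q - s = 18
  -- r³`.
  have b1 : (√(q - s))⁻¹ ≤ (x + 1 / 2) ^ (-(3 / 4) : ℝ) := by
    rw [Real.rpow_neg ht.le]
    apply inv_anti₀ (Real.rpow_pos_of_pos ht _)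
    apply Real.le_sqrt_of_sq_le
    rw [← Real.rpow_natCast, ← Real.rpow_mul ht.le, hqs]
    have : (x + 1 / 2) = (r * √(3 / 2)) ^ (2 : ℝ) := by
      rw [Real.rpow_two, mul_pow, Real.sq_sqrt (by norm_num), hxr]; ring
    rw [this, ← Real.rpow_mul (by positivity)]
    have e3 : (2 : ℝ) * (3 / 4 * ((2 : ℕ) : ℝ)) = (3 : ℕ) := by norm_num
    rw [e3, Real.rpow_natCast, mul_pow]
    have h2 : √(3 / 2) ≤ 2 := by
      rw [Real.sqrt_le_left (by norm_num)]; norm_num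
    have h8 : √(3 / 2) ^ 3 ≤ 2 ^ 3 := by gcongr
    nlinarith
  -- Both `p - s` and `x + 1/3` contain the factor `3r - 1`; the remaining factors are positive and
  -- easily compared.
  have b2 : (√|p - s|)⁻¹ ≤ |x + 1 / 3| ^ (-(1 / 2) : ℝ) := by
    rw [← inv_sqrt_eq_rpow hxabs.le]
    apply inv_anti₀ (Real.sqrt_pos.2 hxabs)
    apply Real.sqrt_le_sqrt
    rw [hx3, hps, abs_div, abs_mul, abs_mul, abs_of_pos (show 0 < 3 * r + 1 by positivity),
      abs_of_pos (show 0 < 9 / 8 * (r + 1) ^ 3 by positivity), abs_of_pos (show (0 : ℝ) < 6 by norm_num)]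
    have := abs_nonneg (3 * r - 1)
    have : (3 * r + 1) / 6 ≤ 9 / 8 * (r + 1) ^ 3 := by nlinarith [sq_nonneg r]
    nlinarith
  linarith

/-- By Tonelli the slice bounds suffice: their singularities in `x` have orders `3/4` and `1/2`,
both below `1`. -/
lemma lintegral_inv_sqrt_lt_top :
    ∫⁻ z in regionInt, ENNReal.ofReal ((√(bdry₁ z))⁻¹ * (√(bdry₂ z))⁻¹) < ⊤ := by
  have m1 := continuous_bdry₁.measurable
  have m2 := continuous_bdry₂.measurable
  rw [← lintegral_indicator isOpen_regionInt.measurableSet, Measure.volume_eq_prod,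
    lintegral_prod _ (Measurable.aemeasurable
      (Measurable.indicator (by fun_prop) isOpen_regionInt.measurableSet))]
  have hae : ∀ᵐ x : ℝ, ∫⁻ y, regionInt.indicator
      (fun z => ENNReal.ofReal ((√(bdry₁ z))⁻¹ * (√(bdry₂ z))⁻¹)) (x, y)
      ≤ (Set.Ioo (-(1 / 2)) 1).indicator (fun x => ENNReal.ofReal (sliceBound x)) x := by
    filter_upwards [compl_mem_ae_iff.2 (measure_singleton (-(1 / 3) : ℝ)),
      compl_mem_ae_iff.2 (measure_singleton (-(1 / 2) : ℝ)),
      compl_mem_ae_iff.2 (measure_singleton (1 : ℝ))] with x h1 h2 h3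
    by_cases hx : x ∈ Set.Ioo (-(1 / 2) : ℝ) 1
    · rw [Set.indicator_of_mem hx]
      exact lintegral_slice_le hx h1
    · have (y : ℝ) : (x, y) ∉ regionInt := fun hy => by
        obtain ⟨a, b, -, -⟩ := region_bounds (regionInt_subset_region hy)
        exact hx ⟨lt_of_le_of_ne a (Ne.symm h2), lt_of_le_of_ne b h3⟩
      simp [this]
  refine (lintegral_mono_ae hae).trans_lt ?_
  rw [lintegral_indicator measurableSet_Ioo]
  exact integrableOn_sliceBound.lintegral_lt_top

/-! ### Integrability of the weight and definiteness of the inner product. -/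

lemma measurable_weight (α β : ℝ) : Measurable (weight α β) := by
  have m1 := continuous_bdry₁.measurable
  have m2 := continuous_bdry₂.measurable
  unfold weight
  fun_prop

lemma weightConst_pos (α β : ℝ) :
    0 < (4 * Real.pi ^ 2) ^ (α + β) / (3 : ℝ) ^ (2 * α + β) := by positivity

lemma weight_pos (α β : ℝ) {z : ℝ × ℝ} (hz : z ∈ regionInt) : 0 < weight α β z :=
  mul_pos (mul_pos (weightConst_pos α β) (Real.rpow_pos_of_pos hz.1 _))
    (Real.rpow_pos_of_pos hz.2 _)

lemma weight_nonneg (α β : ℝ) {z : ℝ × ℝ} (hz : z ∈ region) : 0 ≤ weight α β z :=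
  mul_nonneg (mul_nonneg (weightConst_pos α β).le (Real.rpow_nonneg hz.1 _))
    (Real.rpow_nonneg hz.2 _)

section

variable {α β : ℝ}

lemma integrableOn_weight (hα : -(1 / 2) ≤ α) (hβ : -(1 / 2) ≤ β) :
    IntegrableOn (weight α β) region := by
  rw [IntegrableOn, restrict_region]
  have m1 := continuous_bdry₁.measurable
  have m2 := continuous_bdry₂.measurable
  have h0 : IntegrableOn (fun z => (√(bdry₁ z))⁻¹ * (√(bdry₂ z))⁻¹) regionInt := by
    refine ⟨by fun_prop, ?_⟩
    rw [hasFiniteIntegral_iff_ofReal (.of_forall fun z => by positivity)]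
    exact lintegral_inv_sqrt_lt_top
  -- The exponents `α + 1/2` and `β + 1/2` are nonnegative, so this factor is continuous, hence
  -- bounded on the compact region; what remains is `(f₁ f₂)^{-1/2}`.
  set M : ℝ × ℝ → ℝ := fun z => (4 * Real.pi ^ 2) ^ (α + β) / (3 : ℝ) ^ (2 * α + β)
    * bdry₁ z ^ (α + 1 / 2) * bdry₂ z ^ (β + 1 / 2) with hM
  have hMc : Continuous M :=
    (continuous_const.mul (continuous_bdry₁.rpow_const fun z => Or.inr (by linarith))).mul
      (continuous_bdry₂.rpow_const fun z => Or.inr (by linarith))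
  obtain ⟨B, hB⟩ := isCompact_region.exists_bound_of_continuousOn hMc.continuousOn
  refine (h0.const_mul B).mono' (measurable_weight α β).aestronglyMeasurable ?_
  filter_upwards [ae_restrict_mem isOpen_regionInt.measurableSet] with z hz
  have e : weight α β z = M z * ((√(bdry₁ z))⁻¹ * (√(bdry₂ z))⁻¹) := by
    rw [inv_sqrt_eq_rpow hz.1.le, inv_sqrt_eq_rpow hz.2.le, weight, hM]
    have e1 : bdry₁ z ^ α = bdry₁ z ^ (α + 1 / 2) * bdry₁ z ^ (-(1 / 2) : ℝ) := by
      rw [← Real.rpow_add hz.1]; congr 1; ring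
    have e2 : bdry₂ z ^ β = bdry₂ z ^ (β + 1 / 2) * bdry₂ z ^ (-(1 / 2) : ℝ) := by
      rw [← Real.rpow_add hz.2]; congr 1; ring
    rw [e1, e2]
    ring
  rw [e, norm_mul, Real.norm_of_nonneg (show 0 ≤ (√(bdry₁ z))⁻¹ * (√(bdry₂ z))⁻¹ by positivity)]
  gcongr
  exact hB z (regionInt_subset_region hz)

lemma integrableOn_mul_weight {𝕜 : Type*} [RCLike 𝕜] (hα : -(1 / 2) ≤ α) (hβ : -(1 / 2) ≤ β)
    {f : ℝ × ℝ → 𝕜} (hf : Continuous f) :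
    IntegrableOn (fun z => f z * (weight α β z : 𝕜)) region :=
  IntegrableOn.continuousOn_mul hf.continuousOn (integrableOn_weight hα hβ).ofReal isCompact_region

/-- The weight is positive on the interior, so `f` vanishes there almost everywhere, and by
continuity everywhere on this open set. -/
lemma eqOn_zero_of_integral_eq_zero (hα : -(1 / 2) ≤ α) (hβ : -(1 / 2) ≤ β) {f : ℝ × ℝ → ℝ}
    (hf : Continuous f) (h0 : ∀ z, 0 ≤ f z) (h : ∫ z in region, f z * weight α β z = 0) :
    Set.EqOn f 0 regionInt := by
  have hi : IntegrableOn (fun z => f z * weight α β z) region :=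
    integrableOn_mul_weight (𝕜 := ℝ) hα hβ hf
  rw [restrict_region] at h
  rw [IntegrableOn, restrict_region] at hi
  have hmem := ae_restrict_mem (μ := (volume : Measure (ℝ × ℝ))) isOpen_regionInt.measurableSet
  rw [integral_eq_zero_iff_of_nonneg_ae (hmem.mono fun z hz =>
    mul_nonneg (h0 z) (weight_pos α β hz).le) hi] at h
  refine Measure.eqOn_open_of_ae_eq (μ := volume) ?_ isOpen_regionInt hf.continuousOn
    continuousOn_const
  filter_upwards [h, hmem] with z h1 h2
  exact (mul_eq_zero.1 h1).resolve_right (weight_pos α β h2).ne'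

lemma integral_weight_pos (hα : -(1 / 2) ≤ α) (hβ : -(1 / 2) ≤ β) :
    0 < ∫ z in region, weight α β z := by
  refine lt_of_le_of_ne (setIntegral_nonneg isClosed_region.measurableSet
    fun z hz => weight_nonneg α β hz) fun h => ?_
  obtain ⟨z, hz⟩ := regionInt_nonempty
  have := eqOn_zero_of_integral_eq_zero hα hβ (f := fun _ => 1) continuous_const
    (fun _ => zero_le_one) (by simpa using h.symm) hz
  simp at this

end

/-- The nonempty open interior contains a product of two infinite sets, which is enough to determine
a polynomial in two variables. -/
lemma eq_zero_of_polyFun_eq_zero {𝕜 : Type*} [RCLike 𝕜] {p : MvPolynomial (Fin 2) 𝕜}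
    (h : ∀ z ∈ regionInt, polyFun p z = 0) : p = 0 := by
  obtain ⟨⟨a, b⟩, hz⟩ := regionInt_nonempty
  obtain ⟨u, v, hu, hv, ha, hb, huv⟩ := isOpen_prod_iff.1 isOpen_regionInt a b hz
  have hinj : Function.Injective (RCLike.ofReal : ℝ → 𝕜) := RCLike.ofReal_injective
  refine MvPolynomial.funext_set ![RCLike.ofReal '' u, RCLike.ofReal '' v] (fun i => ?_)
    fun x hx => ?_
  · fin_cases i
    · exact (infinite_of_mem_nhds a (hu.mem_nhds ha)).image hinj.injOn
    · exact (infinite_of_mem_nhds b (hv.mem_nhds hb)).image hinj.injOn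
  · obtain ⟨s, hs, hs'⟩ := hx 0 trivial
    obtain ⟨t, ht, ht'⟩ := hx 1 trivial
    have e : x = ![(s : 𝕜), (t : 𝕜)] := by
      ext i; fin_cases i
      · exact hs'.symm
      · exact ht'.symm
    have := h (s, t) (huv ⟨hs, ht⟩)
    rw [e, map_zero]
    exact this

/-! ### Cutoff functions -/

/-- A smooth function that is `0` on `(-∞, 1]` and `1` on `[2, ∞)`. -/
def cutoff (s : ℝ) : ℝ := Real.smoothTransition (s - 1)

/-- `s ψ'(s)` for the cutoff function `ψ`. -/
def cutoffErr (s : ℝ) : ℝ := s * deriv cutoff s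

/-- A `C¹` approximation of `t ^ α` that vanishes near `t ≤ 0`. -/
def cutoffPow (α : ℝ) (n : ℕ) (t : ℝ) : ℝ := t ^ α * cutoff ((n + 1) * t)

lemma contDiff_cutoff : ContDiff ℝ 1 cutoff :=
  Real.smoothTransition.contDiff (n := 1).comp (contDiff_id.sub contDiff_const)

lemma cutoff_eq_zero {s : ℝ} (h : s ≤ 1) : cutoff s = 0 :=
  Real.smoothTransition.zero_of_nonpos (by linarith)

lemma cutoff_eq_one {s : ℝ} (h : 2 ≤ s) : cutoff s = 1 :=
  Real.smoothTransition.one_of_one_le (by linarith)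

lemma abs_cutoff_le_one (s : ℝ) : |cutoff s| ≤ 1 := by
  rw [cutoff, abs_of_nonneg (Real.smoothTransition.nonneg _)]
  exact Real.smoothTransition.le_one _

lemma cutoffErr_eq_zero_of_lt {s : ℝ} (h : s < 1) : cutoffErr s = 0 := by
  have : cutoff =ᶠ[𝓝 s] fun _ => 0 := by
    filter_upwards [Iio_mem_nhds h] with t ht using cutoff_eq_zero (le_of_lt ht)
  rw [cutoffErr, this.deriv_eq]; simp

lemma cutoffErr_eq_zero_of_gt {s : ℝ} (h : 2 < s) : cutoffErr s = 0 := by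
  have : cutoff =ᶠ[𝓝 s] fun _ => 1 := by
    filter_upwards [Ioi_mem_nhds h] with t ht using cutoff_eq_one (le_of_lt ht)
  rw [cutoffErr, this.deriv_eq]; simp

lemma continuous_cutoffErr : Continuous cutoffErr :=
  continuous_id.mul (contDiff_cutoff.continuous_deriv le_rfl)

lemma exists_abs_cutoffErr_le : ∃ R, 0 ≤ R ∧ ∀ s, |cutoffErr s| ≤ R := by
  obtain ⟨R, hR⟩ := (isCompact_Icc (a := (1 : ℝ)) (b := 2)).exists_bound_of_continuousOn
    continuous_cutoffErr.continuousOn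
  have hR0 : 0 ≤ R := (norm_nonneg _).trans (hR 1 (by norm_num))
  refine ⟨R, hR0, fun s => ?_⟩
  rcases lt_or_ge s 1 with h | h
  · simpa [cutoffErr_eq_zero_of_lt h]
  rcases lt_or_ge 2 s with h' | h'
  · simpa [cutoffErr_eq_zero_of_gt h']
  exact hR s ⟨h, h'⟩

lemma cutoffPow_eq_zero (α : ℝ) (n : ℕ) {t : ℝ} (h : t ≤ 1 / (n + 1)) : cutoffPow α n t = 0 := by
  rw [cutoffPow, cutoff_eq_zero, mul_zero]
  rwa [mul_comm, ← le_div_iff₀ (by positivity)]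

lemma contDiff_cutoffPow (α : ℝ) (n : ℕ) : ContDiff ℝ 1 (cutoffPow α n) := by
  rw [contDiff_iff_contDiffAt]
  intro t
  rcases le_or_gt t 0 with h | h
  · have : cutoffPow α n =ᶠ[𝓝 t] fun _ => 0 := by
      have h' : t < 1 / ((n : ℝ) + 1) := lt_of_le_of_lt h (by positivity)
      filter_upwards [Iio_mem_nhds h'] with s hs using cutoffPow_eq_zero α n (le_of_lt hs)
    exact contDiffAt_const.congr_of_eventuallyEq this
  · exact (Real.contDiffAt_rpow_const_of_ne h.ne').mul
      (contDiff_cutoff.contDiffAt.comp t (contDiffAt_const.mul contDiffAt_id))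

/-- The derivative alone is of size `t^{α-1}`; the extra factor `t`, supplied later by the tangency
of the flux, brings it back to `t^α` times a quantity bounded uniformly in `n`. -/
lemma mul_deriv_cutoffPow (α : ℝ) (n : ℕ) {t : ℝ} (h : 0 < t) :
    t * deriv (cutoffPow α n) t
      = t ^ α * (α * cutoff ((n + 1) * t) + cutoffErr ((n + 1) * t)) := by
  have h1 : HasDerivAt (fun s : ℝ => cutoff ((n + 1) * s))
      (deriv cutoff ((n + 1) * t) * ((n + 1) * 1)) t :=
    ((contDiff_cutoff.differentiable one_ne_zero _).hasDerivAt).comp t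
      ((hasDerivAt_id t).const_mul _)
  have h2 := (Real.hasDerivAt_rpow_const (p := α) (Or.inl h.ne')).mul h1
  have h3 : deriv (cutoffPow α n) t = _ := h2.deriv
  rw [h3, cutoffErr, Real.rpow_sub_one h.ne']
  field_simp

lemma tendsto_cutoff_mul {t : ℝ} (h : 0 < t) :
    Tendsto (fun n : ℕ => cutoff ((n + 1) * t)) atTop (𝓝 1) ∧
    Tendsto (fun n : ℕ => cutoffErr ((n + 1) * t)) atTop (𝓝 0) := by
  have hev : ∀ᶠ n : ℕ in atTop, 2 < ((n : ℝ) + 1) * t := by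
    filter_upwards [tendsto_natCast_atTop_atTop.eventually_gt_atTop (2 / t)] with n hn
    rw [div_lt_iff₀ h] at hn
    linarith
  exact ⟨tendsto_const_nhds.congr' (hev.mono fun n hn => (cutoff_eq_one hn.le).symm),
    tendsto_const_nhds.congr' (hev.mono fun n hn => (cutoffErr_eq_zero_of_gt hn).symm)⟩

/-! ### Integration by parts -/

lemma integral_fderiv_apply_eq_zero {F : ℝ × ℝ → ℝ} (hF : ContDiff ℝ 1 F)
    (hs : HasCompactSupport F) (v : ℝ × ℝ) : ∫ z, fderiv ℝ F z v = 0 := by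
  have h1 : Integrable (fun z => fderiv ℝ F z v) :=
    ((hF.continuous_fderiv one_ne_zero).clm_apply continuous_const).integrable_of_hasCompactSupport
      (hs.fderiv_apply ℝ v)
  have h2 : Integrable F := hF.continuous.integrable_of_hasCompactSupport hs
  -- Integration by parts against the constant function `1`.
  have := integral_mul_fderiv_eq_neg_fderiv_mul_of_integrable (𝕜 := ℝ) (μ := volume)
    (f := fun _ : ℝ × ℝ => (1 : ℝ)) (g := F) (v := v) (by simp) (by simpa using h1)
    (by simpa using h2) (fun _ _ => by fun_prop) (fun z _ => hF.differentiable one_ne_zero z)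
  simpa using this

lemma fderiv_apply_fst {F : ℝ × ℝ → ℝ} {z : ℝ × ℝ} (hF : DifferentiableAt ℝ F z) {F' : ℝ}
    (h : HasDerivAt (fun s => F (s, z.2)) F' z.1) : fderiv ℝ F z (1, 0) = F' := by
  have h1 : HasDerivAt (fun s : ℝ => (s, z.2)) (1, 0) z.1 :=
    (hasDerivAt_id z.1).prodMk (hasDerivAt_const z.1 z.2)
  exact (hF.hasFDerivAt.comp_hasDerivAt (f := fun s : ℝ => (s, z.2)) z.1 h1).unique h

lemma fderiv_apply_snd {F : ℝ × ℝ → ℝ} {z : ℝ × ℝ} (hF : DifferentiableAt ℝ F z) {F' : ℝ}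
    (h : HasDerivAt (fun s => F (z.1, s)) F' z.2) : fderiv ℝ F z (0, 1) = F' := by
  have h1 : HasDerivAt (fun s : ℝ => (z.1, s)) (0, 1) z.2 :=
    (hasDerivAt_const z.2 z.1).prodMk (hasDerivAt_id z.2)
  exact (hF.hasFDerivAt.comp_hasDerivAt (f := fun s : ℝ => (z.1, s)) z.2 h1).unique h

lemma contDiff_bdry₁ {n : WithTop ℕ∞} : ContDiff ℝ n bdry₁ := by unfold bdry₁; fun_prop

lemma contDiff_bdry₂ {n : WithTop ℕ∞} : ContDiff ℝ n bdry₂ := by unfold bdry₂; fun_prop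

/-- The integral of the divergence of `G(f₁) H(f₂) U` vanishes for cutoff functions `G`, `H`. -/
lemma integral_divergence_eq_zero {G H : ℝ → ℝ} {ε : ℝ} (hε : 0 < ε) (hG : ContDiff ℝ 1 G)
    (hH : ContDiff ℝ 1 H) (hG0 : ∀ t ≤ ε, G t = 0) (hH0 : ∀ t ≤ ε, H t = 0)
    (U V : MvPolynomial (Fin 2) ℝ) :
    ∫ z in regionInt,
      (deriv G (bdry₁ z) * H (bdry₂ z) * (-6 * z.1 * polyFun U z + 2 * polyFun V z)
      + G (bdry₁ z) * deriv H (bdry₂ z) * ((72 * z.1 ^ 2 - 12 * z.2 - 6) * polyFun U z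
          + (-2 * z.2 - 12 * z.1 - 4) * polyFun V z)
      + G (bdry₁ z) * H (bdry₂ z) * (polyFun (pderiv 0 U) z + polyFun (pderiv 1 V) z)) = 0 := by
  have hF (W : MvPolynomial (Fin 2) ℝ) :
      ContDiff ℝ 1 (fun z => G (bdry₁ z) * H (bdry₂ z) * polyFun W z) :=
    ((hG.comp contDiff_bdry₁).mul (hH.comp contDiff_bdry₂)).mul (contDiff_polyFun W)
  have hs (W : MvPolynomial (Fin 2) ℝ) :
      HasCompactSupport (fun z => G (bdry₁ z) * H (bdry₂ z) * polyFun W z) := by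
    refine HasCompactSupport.intro isCompact_region fun z hz => ?_
    by_cases h1 : bdry₁ z ≤ ε
    · simp [hG0 _ h1]
    by_cases h2 : bdry₂ z ≤ ε
    · simp [hH0 _ h2]
    exact absurd ⟨by linarith, by linarith⟩ hz
  have dG (t : ℝ) : HasDerivAt G (deriv G t) t := (hG.differentiable one_ne_zero t).hasDerivAt
  have dH (t : ℝ) : HasDerivAt H (deriv H t) t := (hH.differentiable one_ne_zero t).hasDerivAt
  have e1 (z : ℝ × ℝ) := fderiv_apply_fst ((hF U).differentiable one_ne_zero z)
    ((((dG _).comp z.1 (hasDerivAt_bdry₁_fst z)).mul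
      ((dH _).comp z.1 (hasDerivAt_bdry₂_fst z))).mul (hasDerivAt_polyFun_fst U z))
  have e2 (z : ℝ × ℝ) := fderiv_apply_snd ((hF V).differentiable one_ne_zero z)
    ((((dG _).comp z.2 (hasDerivAt_bdry₁_snd z)).mul
      ((dH _).comp z.2 (hasDerivAt_bdry₂_snd z))).mul (hasDerivAt_polyFun_snd V z))
  have i1 := integral_fderiv_apply_eq_zero (hF U) (hs U) (1, 0)
  have i2 := integral_fderiv_apply_eq_zero (hF V) (hs V) (0, 1)
  have int (W : MvPolynomial (Fin 2) ℝ) (v : ℝ × ℝ) :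
      Integrable (fun z => fderiv ℝ (fun z => G (bdry₁ z) * H (bdry₂ z) * polyFun W z) z v) :=
    (((hF W).continuous_fderiv one_ne_zero).clm_apply
      continuous_const).integrable_of_hasCompactSupport ((hs W).fderiv_apply ℝ v)
  have i3 := integral_add (int U (1, 0)) (int V (0, 1))
  rw [i1, i2, add_zero] at i3
  -- Because `ε > 0`, the derivatives of `G` and `H` also vanish on `t ≤ 0`. The integrand is thus
  -- zero off the interior, and the integral extends to the whole plane.
  have d0 {K : ℝ → ℝ} (hK : ∀ t ≤ ε, K t = 0) {t : ℝ} (ht : t ≤ 0) : deriv K t = 0 := by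
    have : K =ᶠ[𝓝 t] fun _ => 0 := by
      filter_upwards [Iio_mem_nhds (ht.trans_lt hε)] with s hs using hK s (le_of_lt hs)
    rw [this.deriv_eq]; simp
  rw [setIntegral_eq_integral_of_forall_compl_eq_zero, ← i3]
  · refine integral_congr_ae (.of_forall fun z => ?_)
    simp only [e1, e2]
    simp only [Function.comp_apply, Pi.mul_apply]
    ring
  · intro z hz
    by_cases h1 : bdry₁ z ≤ 0
    · simp [hG0 _ (h1.trans hε.le), d0 hG0 h1]
    by_cases h2 : bdry₂ z ≤ 0
    · simp [hH0 _ (h2.trans hε.le), d0 hH0 h2]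
    exact absurd ⟨by linarith, by linarith⟩ hz

/-- The first component of the vector field `q Λ ∇ p - p Λ ∇ q`. -/
def wronskian₁ (p q : MvPolynomial (Fin 2) ℝ) : MvPolynomial (Fin 2) ℝ := q * flux₁ p - p * flux₁ q

/-- The second component of the vector field `q Λ ∇ p - p Λ ∇ q`. -/
def wronskian₂ (p q : MvPolynomial (Fin 2) ℝ) : MvPolynomial (Fin 2) ℝ := q * flux₂ p - p * flux₂ q

lemma polyFun_flux₁ (p : MvPolynomial (Fin 2) ℝ) (z : ℝ × ℝ) : polyFun (flux₁ p) z =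
    A₁₁ z * polyFun (pderiv 0 p) z + A₁₂ z * polyFun (pderiv 1 p) z := by
  simp [flux₁, polyFun_polyA₁₁, polyFun_polyA₁₂]

lemma polyFun_flux₂ (p : MvPolynomial (Fin 2) ℝ) (z : ℝ × ℝ) : polyFun (flux₂ p) z =
    A₁₂ z * polyFun (pderiv 0 p) z + A₂₂ z * polyFun (pderiv 1 p) z := by
  simp [flux₂, polyFun_polyA₂₂, polyFun_polyA₁₂]

/-- `∇ f₁ · (q Λ ∇ p - p Λ ∇ q) / f₁`. -/
def normal₁ (p q : MvPolynomial (Fin 2) ℝ) (z : ℝ × ℝ) : ℝ :=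
  (-12 * z.1 - 6) * (polyFun q z * polyFun (pderiv 0 p) z - polyFun p z * polyFun (pderiv 0 q) z)
  + (-36 * z.1 - 18 * z.2) *
    (polyFun q z * polyFun (pderiv 1 p) z - polyFun p z * polyFun (pderiv 1 q) z)

/-- `∇ f₂ · (q Λ ∇ p - p Λ ∇ q) / f₂`. -/
def normal₂ (p q : MvPolynomial (Fin 2) ℝ) (z : ℝ × ℝ) : ℝ :=
  (-18 * z.1) * (polyFun q z * polyFun (pderiv 0 p) z - polyFun p z * polyFun (pderiv 0 q) z)
  + (-18 - 36 * z.2) *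
    (polyFun q z * polyFun (pderiv 1 p) z - polyFun p z * polyFun (pderiv 1 q) z)

lemma grad_bdry₁_wronskian (p q : MvPolynomial (Fin 2) ℝ) (z : ℝ × ℝ) :
    -6 * z.1 * polyFun (wronskian₁ p q) z + 2 * polyFun (wronskian₂ p q) z
      = bdry₁ z * normal₁ p q z := by
  simp only [wronskian₁, wronskian₂, polyFun_sub, polyFun_mul, polyFun_flux₁, polyFun_flux₂,
    normal₁]
  linear_combination
    (polyFun q z * polyFun (pderiv 0 p) z - polyFun p z * polyFun (pderiv 0 q) z)
      * A_grad_bdry₁_fst z +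
    (polyFun q z * polyFun (pderiv 1 p) z - polyFun p z * polyFun (pderiv 1 q) z)
      * A_grad_bdry₁_snd z

lemma grad_bdry₂_wronskian (p q : MvPolynomial (Fin 2) ℝ) (z : ℝ × ℝ) :
    (72 * z.1 ^ 2 - 12 * z.2 - 6) * polyFun (wronskian₁ p q) z
      + (-2 * z.2 - 12 * z.1 - 4) * polyFun (wronskian₂ p q) z = bdry₂ z * normal₂ p q z := by
  simp only [wronskian₁, wronskian₂, polyFun_sub, polyFun_mul, polyFun_flux₁, polyFun_flux₂,
    normal₂]
  linear_combination
    (polyFun q z * polyFun (pderiv 0 p) z - polyFun p z * polyFun (pderiv 0 q) z)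
      * A_grad_bdry₂_fst z +
    (polyFun q z * polyFun (pderiv 1 p) z - polyFun p z * polyFun (pderiv 1 q) z)
      * A_grad_bdry₂_snd z

/-- Green's identity divided by the weight: symmetry of `Λ` cancels the terms `∇p · Λ ∇q`, and the
weight contributes its logarithmic derivative along the Wronskian field. -/
lemma polyFun_jacobiOpPoly_antisymm (α β : ℝ) (p q : MvPolynomial (Fin 2) ℝ) (z : ℝ × ℝ) :
    polyFun p z * polyFun (jacobiOpPoly α β q) z - polyFun q z * polyFun (jacobiOpPoly α β p) z
      = polyFun (pderiv 0 (wronskian₁ p q)) z + polyFun (pderiv 1 (wronskian₂ p q)) z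
        + α * normal₁ p q z + β * normal₂ p q z := by
  simp only [jacobiOpPoly_eq, wronskian₁, wronskian₂, map_sub, Derivation.leibniz, smul_eq_mul,
    polyFun_add, polyFun_sub, polyFun_mul, polyFun_neg, polyFun_flux₁, polyFun_flux₂, polyFun_C,
    normal₁, normal₂]
  simp [polyFun]
  ring

lemma continuous_normal₁ (p q : MvPolynomial (Fin 2) ℝ) : Continuous (normal₁ p q) := by
  have h (i : Fin 2) := ((continuous_polyFun q).mul (continuous_polyFun (pderiv i p))).sub
    ((continuous_polyFun p).mul (continuous_polyFun (pderiv i q)))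
  exact (Continuous.mul (by fun_prop) (h 0)).add (Continuous.mul (by fun_prop) (h 1))

lemma continuous_normal₂ (p q : MvPolynomial (Fin 2) ℝ) : Continuous (normal₂ p q) := by
  have h (i : Fin 2) := ((continuous_polyFun q).mul (continuous_polyFun (pderiv i p))).sub
    ((continuous_polyFun p).mul (continuous_polyFun (pderiv i q)))
  exact (Continuous.mul (by fun_prop) (h 0)).add (Continuous.mul (by fun_prop) (h 1))

/-- `L` is symmetric with respect to the weight. -/
theorem integral_jacobiOpPoly_symm {α β : ℝ} (hα : -(1 / 2) ≤ α) (hβ : -(1 / 2) ≤ β)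
    (p q : MvPolynomial (Fin 2) ℝ) :
    ∫ z in region, polyFun p z * polyFun (jacobiOpPoly α β q) z * weight α β z
      = ∫ z in region, polyFun q z * polyFun (jacobiOpPoly α β p) z * weight α β z := by
  have hint (f g : MvPolynomial (Fin 2) ℝ) :
      IntegrableOn (fun z => polyFun f z * polyFun g z * weight α β z) region :=
    integrableOn_mul_weight (𝕜 := ℝ) hα hβ ((continuous_polyFun f).mul (continuous_polyFun g))
  rw [← sub_eq_zero, ← integral_sub (hint _ _) (hint _ _), restrict_region]
  set N1 := normal₁ p q with hN1
  set N2 := normal₂ p q with hN2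
  set D := fun z => polyFun (pderiv 0 (wronskian₁ p q)) z + polyFun (pderiv 1 (wronskian₂ p q)) z
    with hD
  have cN1 : Continuous N1 := continuous_normal₁ p q
  have cN2 : Continuous N2 := continuous_normal₂ p q
  have cD : Continuous D := (continuous_polyFun _).add (continuous_polyFun _)
  have m1 := continuous_bdry₁.measurable
  have m2 := continuous_bdry₂.measurable
  have mw := measurable_weight α β
  have mc := contDiff_cutoff.continuous.measurable
  have me := continuous_cutoffErr.measurable
  -- Up to the constant of the weight, this is the divergence of the Wronskian field multiplied by
  -- the cut-off powers of `f₁` and `f₂`, rewritten so that the true weight factors out.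
  set Φ : ℕ → ℝ × ℝ → ℝ := fun n z =>
    ((α * cutoff ((n + 1) * bdry₁ z) + cutoffErr ((n + 1) * bdry₁ z))
        * cutoff ((n + 1) * bdry₂ z) * N1 z
      + cutoff ((n + 1) * bdry₁ z)
        * (β * cutoff ((n + 1) * bdry₂ z) + cutoffErr ((n + 1) * bdry₂ z)) * N2 z
      + cutoff ((n + 1) * bdry₁ z) * cutoff ((n + 1) * bdry₂ z) * D z) * weight α β z with hΦ
  have hmem := ae_restrict_mem (μ := (volume : Measure (ℝ × ℝ))) isOpen_regionInt.measurableSet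
  have hzero (n : ℕ) : ∫ z in regionInt, Φ n z = 0 := by
    have h := integral_divergence_eq_zero (ε := 1 / ((n : ℝ) + 1)) (by positivity)
      (contDiff_cutoffPow α n) (contDiff_cutoffPow β n) (fun t => cutoffPow_eq_zero α n)
      (fun t => cutoffPow_eq_zero β n) (wronskian₁ p q) (wronskian₂ p q)
    rw [← mul_zero ((4 * Real.pi ^ 2) ^ (α + β) / (3 : ℝ) ^ (2 * α + β)), ← h,
      ← integral_const_mul]
    refine setIntegral_congr_fun isOpen_regionInt.measurableSet fun z hz => ?_
    have k1 := mul_deriv_cutoffPow α n hz.1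
    have k2 := mul_deriv_cutoffPow β n hz.2
    simp only [grad_bdry₁_wronskian, grad_bdry₂_wronskian]
    simp only [hΦ, ← hN1, ← hN2]
    rw [show deriv (cutoffPow α n) (bdry₁ z) * cutoffPow β n (bdry₂ z) * (bdry₁ z * N1 z)
        = (bdry₁ z * deriv (cutoffPow α n) (bdry₁ z)) * cutoffPow β n (bdry₂ z) * N1 z by ring,
      show cutoffPow α n (bdry₁ z) * deriv (cutoffPow β n) (bdry₂ z) * (bdry₂ z * N2 z)
        = cutoffPow α n (bdry₁ z) * (bdry₂ z * deriv (cutoffPow β n) (bdry₂ z)) * N2 z by ring,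
      k1, k2]
    simp only [cutoffPow, weight, hD]
    ring
  obtain ⟨R, hR0, hR⟩ := exists_abs_cutoffErr_le
  set bound : ℝ × ℝ → ℝ := fun z =>
    ((|α| + R) * |N1 z| + (|β| + R) * |N2 z| + |D z|) * weight α β z with hbound
  have hb : Integrable bound (volume.restrict regionInt) := by
    rw [← restrict_region]
    exact integrableOn_mul_weight (𝕜 := ℝ) hα hβ (f := fun z =>
      (|α| + R) * |N1 z| + (|β| + R) * |N2 z| + |D z|) (by fun_prop)
  -- At each interior point the cutoffs are eventually `1` and their error terms eventually `0`, so
  -- the limit is the integrand of Green's identity.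
  have hlim := tendsto_integral_of_dominated_convergence (μ := volume.restrict regionInt)
    (F := Φ) (f := fun z => (α * N1 z + β * N2 z + D z) * weight α β z) bound
    (fun n => by
      apply Measurable.aestronglyMeasurable
      have := cN1.measurable
      have := cN2.measurable
      have := cD.measurable
      fun_prop)
    hb
    (fun n => by
      filter_upwards [hmem] with z hz
      have hw := (weight_pos α β hz).le
      have c1 := abs_cutoff_le_one ((n + 1) * bdry₁ z)
      have c2 := abs_cutoff_le_one ((n + 1) * bdry₂ z)
      have e1 := hR ((n + 1) * bdry₁ z)
      have e2 := hR ((n + 1) * bdry₂ z)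
      have lin (a c e : ℝ) (hc : |c| ≤ 1) (he : |e| ≤ R) : |a * c + e| ≤ |a| + R := by
        refine (abs_add_le _ _).trans (add_le_add ?_ he)
        rw [abs_mul]
        exact mul_le_of_le_one_right (abs_nonneg _) hc
      have l1 := lin α _ _ c1 e1
      have l2 := lin β _ _ c2 e2
      rw [hΦ, hbound, Real.norm_eq_abs, abs_mul, abs_of_nonneg hw]
      refine mul_le_mul_of_nonneg_right ((abs_add_three _ _ _).trans ?_) hw
      simp only [abs_mul]
      have hα0 := abs_nonneg α
      have hβ0 := abs_nonneg β
      refine add_le_add (add_le_add ?_ ?_) ?_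
      · refine mul_le_mul_of_nonneg_right ?_ (abs_nonneg _)
        calc _ ≤ (|α| + R) * 1 := by gcongr
          _ = _ := mul_one _
      · refine mul_le_mul_of_nonneg_right ?_ (abs_nonneg _)
        calc _ ≤ 1 * (|β| + R) := by gcongr
          _ = _ := one_mul _
      · refine mul_le_of_le_one_left (abs_nonneg _) ?_
        calc _ ≤ (1 : ℝ) * 1 := by gcongr
          _ = _ := one_mul _)
    (by
      filter_upwards [hmem] with z hz
      obtain ⟨t1, t2⟩ := tendsto_cutoff_mul hz.1
      obtain ⟨t3, t4⟩ := tendsto_cutoff_mul hz.2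
      have := (((((t1.const_mul α).add t2).mul t3).mul_const (N1 z)).add
        ((t1.mul ((t3.const_mul β).add t4)).mul_const (N2 z))).add ((t1.mul t3).mul_const (D z))
      have := this.mul_const (weight α β z)
      simpa [hΦ] using this)
  simp only [hzero] at hlim
  refine Eq.trans ?_ (tendsto_nhds_unique tendsto_const_nhds hlim).symm
  refine integral_congr_ae (.of_forall fun z => ?_)
  simp only
  rw [← sub_mul, polyFun_jacobiOpPoly_antisymm]
  simp only [hD, ← hN1, ← hN2]
  ring

/-! ### The `*`-order and monomials -/

/-- The second alternative of `StarLT` says that the `m`-degrees agree and the exponent of `y` is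
smaller. The order is therefore lexicographic in `(mDeg k, k.2)`, hence linear. -/
lemma StarLT.trans {i j k : ℕ × ℕ} (h : StarLT i j) (h' : StarLT j k) : StarLT i k := by
  unfold StarLT mDeg at *; omega

lemma starLT_irrefl (k : ℕ × ℕ) : ¬StarLT k k := by
  unfold StarLT mDeg; omega

lemma starLT_trichotomy {j k : ℕ × ℕ} (h : j ≠ k) : StarLT j k ∨ StarLT k j := by
  have : j.1 ≠ k.1 ∨ j.2 ≠ k.2 := by
    by_contra hn
    push Not at hn
    exact h (Prod.ext hn.1 hn.2)
  unfold StarLT mDeg; omega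

lemma StarLE.trans_lt {i j k : ℕ × ℕ} (h : StarLE i j) (h' : StarLT j k) : StarLT i k := by
  rcases h with h | rfl
  exacts [h.trans h', h']

lemma wellFounded_starLT : WellFounded StarLT := by
  -- Since `k.2 ≤ mDeg k`, the gap between consecutive squares outweighs any change of `k.2`, so
  -- this rank increases along the order.
  refine Subrelation.wf (r := InvImage (· < ·) fun k : ℕ × ℕ => (mDeg k + 1) ^ 2 + k.2) ?_
    (InvImage.wf _ wellFounded_lt)
  intro i j h
  unfold StarLT at h
  change (mDeg i + 1) ^ 2 + i.2 < (mDeg j + 1) ^ 2 + j.2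
  have hi : i.2 ≤ mDeg i := by unfold mDeg; omega
  rcases h with h | h
  · nlinarith
  · have e : mDeg i = mDeg j := by unfold mDeg; omega
    rw [e]; omega

lemma finite_starLT (k : ℕ × ℕ) : {j | StarLT j k}.Finite := by
  refine ((Set.finite_Iic (mDeg k)).prod (Set.finite_Iic (mDeg k))).subset fun j hj => ?_
  simp only [Set.mem_ofPred_eq, StarLT, mDeg] at hj
  simp only [Set.mem_prod, Set.mem_Iic, mDeg]
  omega

section

variable {𝕜 : Type*} [RCLike 𝕜]

lemma mono_eq_monomial (k : ℕ × ℕ) :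
    mono 𝕜 k = monomial (Finsupp.single 0 k.1 + Finsupp.single 1 k.2) 1 := by
  rw [mono, X_pow_eq_monomial, X_pow_eq_monomial, monomial_mul, one_mul]

lemma coeffAt_mono (j k : ℕ × ℕ) : coeffAt j (mono 𝕜 k) = if k = j then 1 else 0 := by
  rw [coeffAt, mono_eq_monomial, coeff_monomial]
  congr 1
  refine propext ⟨fun h => ?_, fun h => by rw [h]⟩
  have h0 := DFunLike.congr_fun h 0
  have h1 := DFunLike.congr_fun h 1
  simp at h0 h1
  exact Prod.ext h0 h1

lemma coeffAt_add (j : ℕ × ℕ) (p q : MvPolynomial (Fin 2) 𝕜) :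
    coeffAt j (p + q) = coeffAt j p + coeffAt j q := coeff_add _ _ _

lemma coeffAt_smul (j : ℕ × ℕ) (c : 𝕜) (p : MvPolynomial (Fin 2) 𝕜) :
    coeffAt j (c • p) = c * coeffAt j p := coeff_smul _ _ _

variable (𝕜) in
/-- The span of the monomials strictly below `k` in the `*`-order. -/
def lowSpan (k : ℕ × ℕ) : Submodule 𝕜 (MvPolynomial (Fin 2) 𝕜) :=
  Submodule.span 𝕜 {p | ∃ j, StarLT j k ∧ p = mono 𝕜 j}

lemma mono_mem_lowSpan {j k : ℕ × ℕ} (h : StarLT j k) : mono 𝕜 j ∈ lowSpan 𝕜 k :=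
  Submodule.subset_span ⟨j, h, rfl⟩

lemma lowSpan_mono {j k : ℕ × ℕ} (h : StarLT j k) : lowSpan 𝕜 j ≤ lowSpan 𝕜 k :=
  Submodule.span_mono fun _ ⟨i, hi, e⟩ => ⟨i, hi.trans h, e⟩

lemma coeffAt_eq_zero_of_mem_lowSpan {j k : ℕ × ℕ} {p : MvPolynomial (Fin 2) 𝕜}
    (hp : p ∈ lowSpan 𝕜 k) (h : ¬StarLT j k) : coeffAt j p = 0 := by
  induction hp using Submodule.span_induction with
  | mem p hp =>
    obtain ⟨i, hi, rfl⟩ := hp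
    rw [coeffAt_mono, if_neg]
    rintro rfl
    exact h hi
  | zero => exact coeff_zero _
  | add p q _ _ hp hq => rw [coeffAt_add, hp, hq, add_zero]
  | smul c p _ hp => rw [coeffAt_smul, hp, mul_zero]

lemma mem_piStar_and_hasLeadingTerm {k : ℕ × ℕ} {l : MvPolynomial (Fin 2) 𝕜}
    (hl : l ∈ lowSpan 𝕜 k) :
    mono 𝕜 k + l ∈ PiStar 𝕜 k ∧ HasLeadingTerm (mono 𝕜 k + l) 1 k := by
  refine ⟨add_mem (Submodule.subset_span ⟨k, Or.inr rfl, rfl⟩)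
    (Submodule.span_mono ?_ hl), one_ne_zero, ?_, ?_⟩
  · rintro _ ⟨i, hi, e⟩
    exact ⟨i, Or.inl hi, e⟩
  · rw [coeffAt_add, coeffAt_eq_zero_of_mem_lowSpan hl (starLT_irrefl k), coeffAt_mono]
    simp
  · intro j hj
    by_contra hn
    apply hj
    rw [coeffAt_add, coeffAt_eq_zero_of_mem_lowSpan hl (fun h => hn (Or.inl h)), coeffAt_mono,
      if_neg (fun h => hn (Or.inr h.symm)), add_zero]

lemma sub_mono_mem_lowSpan {k : ℕ × ℕ} {p : MvPolynomial (Fin 2) 𝕜}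
    (hp : p ∈ PiStar 𝕜 k) (h : HasLeadingTerm p 1 k) : p - mono 𝕜 k ∈ lowSpan 𝕜 k := by
  have e : {p | ∃ j, StarLE j k ∧ p = mono 𝕜 j}
      = insert (mono 𝕜 k) {p | ∃ j, StarLT j k ∧ p = mono 𝕜 j} := by
    ext p
    simp only [Set.mem_ofPred_eq, Set.mem_insert_iff, StarLE]
    constructor
    · rintro ⟨j, hj | rfl, rfl⟩
      exacts [Or.inr ⟨j, hj, rfl⟩, Or.inl rfl]
    · rintro (rfl | ⟨j, hj, rfl⟩)
      exacts [⟨k, Or.inr rfl, rfl⟩, ⟨j, Or.inl hj, rfl⟩]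
  rw [PiStar, e, Submodule.mem_span_insert] at hp
  obtain ⟨c, l, hl, rfl⟩ := hp
  change l ∈ lowSpan 𝕜 k at hl
  have hc : c = 1 := by
    have := h.2.1
    rw [coeffAt_add, coeffAt_smul, coeffAt_eq_zero_of_mem_lowSpan hl (starLT_irrefl k),
      coeffAt_mono] at this
    simpa using this
  rw [hc, one_smul, add_sub_cancel_left]
  exact hl

/-! ### Triangularity of the operator -/

variable (𝕜) in
/-- `jacobiOpPoly` as a linear map. -/
def jacobiLin (α β : ℝ) : MvPolynomial (Fin 2) 𝕜 →ₗ[𝕜] MvPolynomial (Fin 2) 𝕜 where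
  toFun := jacobiOpPoly α β
  map_add' p q := by simp only [jacobiOpPoly, map_add]; ring
  map_smul' c p := by
    simp only [jacobiOpPoly, smul_eq_C_mul, RingHom.id_apply, Derivation.leibniz,
      pderiv_C, smul_eq_mul, mul_zero,
      add_zero]
    ring

lemma C_mul_mem {W : Submodule 𝕜 (MvPolynomial (Fin 2) 𝕜)} {p : MvPolynomial (Fin 2) 𝕜} (c : 𝕜)
    (h : p ∈ W) : C c * p ∈ W := by
  rw [← smul_eq_C_mul]; exact W.smul_mem c h

lemma pderiv_zero_mono (a b : ℕ) :
    pderiv 0 (mono 𝕜 (a, b)) = C (a : 𝕜) * mono 𝕜 (a - 1, b) := by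
  simp [mono, Derivation.leibniz, Derivation.leibniz_pow, pderiv_X]
  ring

lemma pderiv_one_mono (a b : ℕ) :
    pderiv 1 (mono 𝕜 (a, b)) = C (b : 𝕜) * mono 𝕜 (a, b - 1) := by
  simp [mono, Derivation.leibniz, Derivation.leibniz_pow, pderiv_X, mul_left_comm]

lemma pow_mul_mono (i j a b : ℕ) :
    X 0 ^ i * X 1 ^ j * mono 𝕜 (a, b) = mono 𝕜 (i + a, j + b) := by
  simp only [mono]; ring

/-- A term `x^i y^j` times a derivative of a monomial lies in `lowSpan` when its exponent does. -/
lemma C_mul_pow_mul_mono_mem {k : ℕ × ℕ} (i j a b : ℕ) (n : ℕ)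
    (h : n ≠ 0 → StarLT (i + a, j + b) k) :
    X 0 ^ i * X 1 ^ j * (C (n : 𝕜) * mono 𝕜 (a, b)) ∈ lowSpan 𝕜 k := by
  rw [mul_left_comm, pow_mul_mono]
  by_cases hn : n = 0
  · simp [hn]
  · exact C_mul_mem _ (mono_mem_lowSpan (h hn))

/-- In this form the eigenvalue is the sum of the contributions of `x²∂ₓ²`, `xy∂ₓ∂ᵧ`, `y²∂ᵧ²`, `x∂ₓ`
and `y∂ᵧ`, the terms that preserve exponents. -/
lemma eigval_eq (α β : ℝ) (a b : ℕ) : eigval α β (a, b) =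
    6 * (a * (a - 1)) + 18 * (a * b) + 18 * (b * (b - 1)) + (21 + 12 * α + 18 * β) * a
      + (45 + 36 * β + 18 * α) * b := by
  simp only [eigval, mDeg]
  push_cast
  ring

/-- Give `x` weight 2 and `y` weight 3. Apart from the diagonal terms, every term lowers the
`m`-degree except `x³∂ᵧ²`, which keeps it but sends `(a, b)` to `(a + 3, b - 2)`, a smaller exponent
in the `*`-order. -/
lemma jacobiOpPoly_mono_sub_mem (α β : ℝ) (k : ℕ × ℕ) :
    jacobiOpPoly α β (mono 𝕜 k) - (eigval α β k : 𝕜) • mono 𝕜 k ∈ lowSpan 𝕜 k := by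
  obtain ⟨a, b⟩ := k
  have d0 := pderiv_zero_mono (𝕜 := 𝕜) a b
  have d1 := pderiv_one_mono (𝕜 := 𝕜) a b
  have d00 : pderiv 0 (pderiv 0 (mono 𝕜 (a, b)))
      = C ((a * (a - 1) : ℕ) : 𝕜) * mono 𝕜 (a - 1 - 1, b) := by
    rw [d0, Derivation.leibniz, pderiv_C, pderiv_zero_mono]
    simp only [smul_eq_mul, mul_zero, add_zero, Nat.cast_mul, C_mul]
    ring
  have d01 : pderiv 0 (pderiv 1 (mono 𝕜 (a, b)))
      = C ((a * b : ℕ) : 𝕜) * mono 𝕜 (a - 1, b - 1) := by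
    rw [d1, Derivation.leibniz, pderiv_C, pderiv_zero_mono]
    simp only [smul_eq_mul, mul_zero, add_zero, Nat.cast_mul, C_mul]
    ring
  have d11 : pderiv 1 (pderiv 1 (mono 𝕜 (a, b)))
      = C ((b * (b - 1) : ℕ) : 𝕜) * mono 𝕜 (a, b - 1 - 1) := by
    rw [d1, Derivation.leibniz, pderiv_C, pderiv_one_mono]
    simp only [smul_eq_mul, mul_zero, add_zero, Nat.cast_mul, C_mul]
    ring
  have x0 : X 0 * pderiv 0 (mono 𝕜 (a, b)) = C (a : 𝕜) * mono 𝕜 (a, b) := by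
    rw [d0]; rcases a with _ | a <;> simp [mono]; ring
  have x1 : X 1 * pderiv 1 (mono 𝕜 (a, b)) = C (b : 𝕜) * mono 𝕜 (a, b) := by
    rw [d1]; rcases b with _ | b <;> simp [mono]; ring
  have x00 : X 0 ^ 2 * pderiv 0 (pderiv 0 (mono 𝕜 (a, b)))
      = C ((a : 𝕜) * (a - 1)) * mono 𝕜 (a, b) := by
    rw [d00]; rcases a with _ | _ | a <;> simp [mono]; ring
  have x01 : X 0 * X 1 * pderiv 0 (pderiv 1 (mono 𝕜 (a, b)))
      = C ((a : 𝕜) * b) * mono 𝕜 (a, b) := by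
    rw [d01]; rcases a with _ | a <;> rcases b with _ | b <;> simp [mono]; ring
  have x11 : X 1 ^ 2 * pderiv 1 (pderiv 1 (mono 𝕜 (a, b)))
      = C ((b : 𝕜) * (b - 1)) * mono 𝕜 (a, b) := by
    rw [d11]; rcases b with _ | _ | b <;> simp [mono]; ring
  -- The exponents after differentiation use truncated subtraction; whenever truncation would
  -- matter, the coefficient is zero.
  have ha2 : a * (a - 1) ≠ 0 → 2 ≤ a := fun h => by
    rcases a with _ | _ | a <;> simp_all
  have hb2 : b * (b - 1) ≠ 0 → 2 ≤ b := fun h => by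
    rcases b with _ | _ | b <;> simp_all
  have hab : a * b ≠ 0 → 1 ≤ a ∧ 1 ≤ b := fun h => by
    rw [mul_ne_zero_iff] at h; omega
  have m00 (i j : ℕ) (h : 2 * i + 3 * j < 4) :
      X 0 ^ i * X 1 ^ j * pderiv 0 (pderiv 0 (mono 𝕜 (a, b))) ∈ lowSpan 𝕜 (a, b) := by
    rw [d00]
    exact C_mul_pow_mul_mono_mem _ _ _ _ _ fun hn => by
      have := ha2 hn
      unfold StarLT mDeg; dsimp only; omega
  have m01 (i j : ℕ) (h : 2 * i + 3 * j < 5) :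
      X 0 ^ i * X 1 ^ j * pderiv 0 (pderiv 1 (mono 𝕜 (a, b))) ∈ lowSpan 𝕜 (a, b) := by
    rw [d01]
    exact C_mul_pow_mul_mono_mem _ _ _ _ _ fun hn => by
      have := hab hn
      unfold StarLT mDeg; dsimp only; omega
  have m11 (i j : ℕ) (h : 2 * i + 3 * j < 6 ∨ (i = 3 ∧ j = 0)) :
      X 0 ^ i * X 1 ^ j * pderiv 1 (pderiv 1 (mono 𝕜 (a, b))) ∈ lowSpan 𝕜 (a, b) := by
    rw [d11]
    exact C_mul_pow_mul_mono_mem _ _ _ _ _ fun hn => by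
      have := hb2 hn
      unfold StarLT mDeg; dsimp only; omega
  have m0 : X 0 ^ 0 * X 1 ^ 0 * pderiv 0 (mono 𝕜 (a, b)) ∈ lowSpan 𝕜 (a, b) := by
    rw [d0]
    exact C_mul_pow_mul_mono_mem _ _ _ _ _ fun hn => by
      unfold StarLT mDeg; dsimp only; omega
  have m1 (i : ℕ) (h : i < 2) :
      X 0 ^ i * X 1 ^ 0 * pderiv 1 (mono 𝕜 (a, b)) ∈ lowSpan 𝕜 (a, b) := by
    rw [d1]
    exact C_mul_pow_mul_mono_mem _ _ _ _ _ fun hn => by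
      unfold StarLT mDeg; dsimp only; omega
  have e : jacobiOpPoly α β (mono 𝕜 (a, b)) - (eigval α β (a, b) : 𝕜) • mono 𝕜 (a, b) =
      C (-1) * (X 0 ^ 0 * X 1 ^ 1 * pderiv 0 (pderiv 0 (mono 𝕜 (a, b))))
      + C (-3) * (X 0 ^ 1 * X 1 ^ 0 * pderiv 0 (pderiv 0 (mono 𝕜 (a, b))))
      + C (-2) * (X 0 ^ 0 * X 1 ^ 0 * pderiv 0 (pderiv 0 (mono 𝕜 (a, b))))
      + C (-36) * (X 0 ^ 2 * X 1 ^ 0 * pderiv 0 (pderiv 1 (mono 𝕜 (a, b))))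
      + C 12 * (X 0 ^ 0 * X 1 ^ 1 * pderiv 0 (pderiv 1 (mono 𝕜 (a, b))))
      + C 6 * (X 0 ^ 0 * X 1 ^ 0 * pderiv 0 (pderiv 1 (mono 𝕜 (a, b))))
      + C (-108) * (X 0 ^ 3 * X 1 ^ 0 * pderiv 1 (pderiv 1 (mono 𝕜 (a, b))))
      + C 54 * (X 0 ^ 1 * X 1 ^ 1 * pderiv 1 (pderiv 1 (mono 𝕜 (a, b))))
      + C 27 * (X 0 ^ 1 * X 1 ^ 0 * pderiv 1 (pderiv 1 (mono 𝕜 (a, b))))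
      + C 9 * (X 0 ^ 0 * X 1 ^ 1 * pderiv 1 (pderiv 1 (mono 𝕜 (a, b))))
      + C (6 * (α : 𝕜) + 3) * (X 0 ^ 0 * X 1 ^ 0 * pderiv 0 (mono 𝕜 (a, b)))
      + C (18 + 36 * (α : 𝕜)) * (X 0 ^ 1 * X 1 ^ 0 * pderiv 1 (mono 𝕜 (a, b)))
      + C (18 * (β : 𝕜) + 9) * (X 0 ^ 0 * X 1 ^ 0 * pderiv 1 (mono 𝕜 (a, b))) := by
    rw [eigval_eq, smul_eq_C_mul]
    push_cast
    simp only [C_mul, C_add, C_sub, C_neg, map_ofNat, map_one] at x0 x1 x00 x01 x11 ⊢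
    unfold jacobiOpPoly
    dsimp only
    linear_combination 6 * x00 + 18 * x01 + 18 * x11
      + (21 + 12 * C (α : 𝕜) + 18 * C (β : 𝕜)) * x0 + (45 + 36 * C (β : 𝕜) + 18 * C (α : 𝕜)) * x1
  rw [e]
  refine add_mem (add_mem (add_mem (add_mem (add_mem (add_mem (add_mem (add_mem (add_mem (add_mem
    (add_mem (add_mem ?_ ?_) ?_) ?_) ?_) ?_) ?_) ?_) ?_) ?_) ?_) ?_) ?_ <;> apply C_mul_mem
  · exact m00 0 1 (by norm_num)
  · exact m00 1 0 (by norm_num)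
  · exact m00 0 0 (by norm_num)
  · exact m01 2 0 (by norm_num)
  · exact m01 0 1 (by norm_num)
  · exact m01 0 0 (by norm_num)
  · exact m11 3 0 (by norm_num)
  · exact m11 1 1 (by norm_num)
  · exact m11 1 0 (by norm_num)
  · exact m11 0 1 (by norm_num)
  · exact m0
  · exact m1 1 (by norm_num)
  · exact m1 0 (by norm_num)

lemma jacobiLin_mem_lowSpan (α β : ℝ) {k : ℕ × ℕ} {p : MvPolynomial (Fin 2) 𝕜}
    (hp : p ∈ lowSpan 𝕜 k) : jacobiLin 𝕜 α β p ∈ lowSpan 𝕜 k := by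
  have : lowSpan 𝕜 k ≤ (lowSpan 𝕜 k).comap (jacobiLin 𝕜 α β) := by
    refine Submodule.span_le.2 ?_
    rintro _ ⟨j, hj, rfl⟩
    have h1 := lowSpan_mono hj (jacobiOpPoly_mono_sub_mem (𝕜 := 𝕜) α β j)
    have := add_mem h1 ((lowSpan 𝕜 k).smul_mem (eigval α β j : 𝕜) (mono_mem_lowSpan hj))
    rwa [sub_add_cancel] at this
  exact this hp

end

/-! ### The weighted inner product on polynomials -/

section

variable {𝕜 : Type*} [RCLike 𝕜] {α β : ℝ}

lemma integrableOn_inner (hα : -(1 / 2) ≤ α) (hβ : -(1 / 2) ≤ β) (p q : MvPolynomial (Fin 2) 𝕜) :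
    IntegrableOn (fun z => polyFun p z * (starRingEnd 𝕜) (polyFun q z) * (weight α β z : 𝕜))
      region :=
  integrableOn_mul_weight hα hβ
    ((continuous_polyFun p).mul (RCLike.continuous_conj.comp (continuous_polyFun q)))

lemma wInner_sub_left (hα : -(1 / 2) ≤ α) (hβ : -(1 / 2) ≤ β) (p q r : MvPolynomial (Fin 2) 𝕜) :
    wInner α β (polyFun (p - q)) (polyFun r)
      = wInner α β (polyFun p) (polyFun r) - wInner α β (polyFun q) (polyFun r) := by
  simp only [wInner, polyFun_sub, sub_mul]
  rw [integral_sub (integrableOn_inner hα hβ p r) (integrableOn_inner hα hβ q r), mul_sub]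

lemma wInner_add_right (hα : -(1 / 2) ≤ α) (hβ : -(1 / 2) ≤ β) (p q r : MvPolynomial (Fin 2) 𝕜) :
    wInner α β (polyFun p) (polyFun (q + r))
      = wInner α β (polyFun p) (polyFun q) + wInner α β (polyFun p) (polyFun r) := by
  simp only [wInner, polyFun_add, map_add, mul_add, add_mul]
  rw [integral_add (integrableOn_inner hα hβ p q) (integrableOn_inner hα hβ p r), mul_add]

lemma wInner_smul_right (c : 𝕜) (p q : MvPolynomial (Fin 2) 𝕜) :
    wInner α β (polyFun p) (polyFun (c • q))
      = (starRingEnd 𝕜) c * wInner α β (polyFun p) (polyFun q) := by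
  simp only [wInner, polyFun_smul, map_mul]
  rw [mul_left_comm, ← integral_const_mul ((starRingEnd 𝕜) c)]
  congr 2
  funext z
  ring

lemma wInner_zero_right (p : MvPolynomial (Fin 2) 𝕜) :
    wInner α β (polyFun p) (polyFun (0 : MvPolynomial (Fin 2) 𝕜)) = 0 := by
  simp [wInner]

lemma wInner_eq_zero_of_mem_lowSpan (hα : -(1 / 2) ≤ α) (hβ : -(1 / 2) ≤ β) {k : ℕ × ℕ}
    {p q : MvPolynomial (Fin 2) 𝕜} (hq : q ∈ lowSpan 𝕜 k)
    (h : ∀ j, StarLT j k → wInner α β (polyFun p) (polyFun (mono 𝕜 j)) = 0) :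
    wInner α β (polyFun p) (polyFun q) = 0 := by
  induction hq using Submodule.span_induction with
  | mem q hq => obtain ⟨j, hj, rfl⟩ := hq; exact h j hj
  | zero => exact wInner_zero_right p
  | add q r _ _ hq hr => rw [wInner_add_right hα hβ, hq, hr, add_zero]
  | smul c q _ hq => rw [wInner_smul_right, hq, mul_zero]

lemma eq_zero_of_wInner_self (hα : -(1 / 2) ≤ α) (hβ : -(1 / 2) ≤ β)
    {p : MvPolynomial (Fin 2) 𝕜} (h : wInner α β (polyFun p) (polyFun p) = 0) : p = 0 := by
  have hc : (((∫ z in region, weight α β z)⁻¹ : ℝ) : 𝕜) ≠ 0 := by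
    exact_mod_cast (inv_pos.2 (integral_weight_pos hα hβ)).ne'
  have h1 := (mul_eq_zero.1 h).resolve_left hc
  have e (z : ℝ × ℝ) : polyFun p z * (starRingEnd 𝕜) (polyFun p z) * (weight α β z : 𝕜)
      = ((‖polyFun p z‖ ^ 2 * weight α β z : ℝ) : 𝕜) := by
    rw [RCLike.mul_conj]; push_cast; rfl
  simp only [e] at h1
  rw [integral_ofReal] at h1
  have h2 := eqOn_zero_of_integral_eq_zero hα hβ ((continuous_polyFun p).norm.pow 2)
    (fun z => sq_nonneg _) (by exact_mod_cast h1)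
  refine eq_zero_of_polyFun_eq_zero fun z hz => ?_
  simpa using h2 hz

lemma eq_zero_of_mem_lowSpan_of_wInner (hα : -(1 / 2) ≤ α) (hβ : -(1 / 2) ≤ β) {k : ℕ × ℕ}
    {p : MvPolynomial (Fin 2) 𝕜} (hp : p ∈ lowSpan 𝕜 k)
    (h : ∀ j, StarLT j k → wInner α β (polyFun p) (polyFun (mono 𝕜 j)) = 0) : p = 0 :=
  eq_zero_of_wInner_self hα hβ (wInner_eq_zero_of_mem_lowSpan hα hβ hp h)

/-- A polynomial with leading term `x^k` is determined by orthogonality to lower monomials. -/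
lemma eq_of_wInner_mono_eq_zero (hα : -(1 / 2) ≤ α) (hβ : -(1 / 2) ≤ β) {k : ℕ × ℕ}
    {p q : MvPolynomial (Fin 2) 𝕜} (hp : p - mono 𝕜 k ∈ lowSpan 𝕜 k)
    (hq : q - mono 𝕜 k ∈ lowSpan 𝕜 k)
    (hp' : ∀ j, StarLT j k → wInner α β (polyFun p) (polyFun (mono 𝕜 j)) = 0)
    (hq' : ∀ j, StarLT j k → wInner α β (polyFun q) (polyFun (mono 𝕜 j)) = 0) : p = q := by
  rw [← sub_eq_zero]
  refine eq_zero_of_mem_lowSpan_of_wInner hα hβ (k := k) ?_ fun j hj => ?_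
  · simpa using sub_mem hp hq
  · rw [wInner_sub_left hα hβ, hp' j hj, hq' j hj, sub_zero]

/-- In a mutually orthogonal family with leading terms `x^k`, each member is orthogonal to all
lower monomials. -/
lemma wInner_mono_eq_zero_of_orthogonal (hα : -(1 / 2) ≤ α) (hβ : -(1 / 2) ≤ β)
    {Q : ℕ × ℕ → MvPolynomial (Fin 2) 𝕜} (hQ : ∀ k, Q k - mono 𝕜 k ∈ lowSpan 𝕜 k)
    (h : ∀ k j, k ≠ j → wInner α β (polyFun (Q k)) (polyFun (Q j)) = 0) (k j : ℕ × ℕ)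
    (hj : StarLT j k) : wInner α β (polyFun (Q k)) (polyFun (mono 𝕜 j)) = 0 := by
  induction j using wellFounded_starLT.induction with
  | _ j ih =>
    have h1 := h k j (by rintro rfl; exact starLT_irrefl _ hj)
    -- Write `Q j` as its leading monomial plus lower terms; the lower terms are orthogonal to `Q k`
    -- by induction.
    rw [← sub_add_cancel (Q j) (mono 𝕜 j), wInner_add_right hα hβ,
      wInner_eq_zero_of_mem_lowSpan hα hβ (hQ j) fun i hi => ih i hi (hi.trans hj), zero_add] at h1
    exact h1

/-! ### The real Jacobi polynomials -/

/-- The linear functional `p ↦ ∫ p w`. -/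
def moment (hα : -(1 / 2) ≤ α) (hβ : -(1 / 2) ≤ β) : MvPolynomial (Fin 2) ℝ →ₗ[ℝ] ℝ where
  toFun p := ∫ z in region, polyFun p z * weight α β z
  map_add' p q := by
    have hi (p : MvPolynomial (Fin 2) ℝ) := integrableOn_mul_weight (𝕜 := ℝ) hα hβ
      (continuous_polyFun p)
    simp only [polyFun_add, add_mul]
    exact integral_add (hi p) (hi q)
  map_smul' c p := by
    simp only [polyFun_smul, mul_assoc, RingHom.id_apply, smul_eq_mul]
    exact integral_const_mul _ _

lemma moment_mul_jacobiLin (hα : -(1 / 2) ≤ α) (hβ : -(1 / 2) ≤ β)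
    (p q : MvPolynomial (Fin 2) ℝ) :
    moment hα hβ (p * jacobiLin ℝ α β q) = moment hα hβ (q * jacobiLin ℝ α β p) := by
  have := integral_jacobiOpPoly_symm hα hβ p q
  simp only [← polyFun_mul] at this
  exact this

lemma eq_zero_of_moment_mul_self (hα : -(1 / 2) ≤ α) (hβ : -(1 / 2) ≤ β)
    {p : MvPolynomial (Fin 2) ℝ} (h : moment hα hβ (p * p) = 0) : p = 0 := by
  have h2 := eqOn_zero_of_integral_eq_zero hα hβ (continuous_polyFun (p * p))
    (fun z => by rw [polyFun_mul]; exact mul_self_nonneg _) h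
  refine eq_zero_of_polyFun_eq_zero fun z hz => ?_
  simpa using h2 hz

/-- Only finitely many monomials lie below `k`, and the positive definite form identifies their span
with its dual. The functional `q ↦ ∫ x^k q w` is thus represented by a lower polynomial, which is
subtracted from the monomial. -/
lemma exists_orthogonal (hα : -(1 / 2) ≤ α) (hβ : -(1 / 2) ≤ β) (k : ℕ × ℕ) :
    ∃ p : MvPolynomial (Fin 2) ℝ, p - mono ℝ k ∈ lowSpan ℝ k ∧
      ∀ q ∈ lowSpan ℝ k, moment hα hβ (p * q) = 0 := by
  set W := lowSpan ℝ k with hW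
  have hfin : FiniteDimensional ℝ W := by
    refine FiniteDimensional.span_of_finite ℝ (((finite_starLT k).image (mono ℝ)).subset ?_)
    rintro _ ⟨j, hj, rfl⟩
    exact ⟨j, hj, rfl⟩
  set B := (LinearMap.mul ℝ (MvPolynomial (Fin 2) ℝ)).compr₂ (moment hα hβ) with hB
  set T : W →ₗ[ℝ] Module.Dual ℝ W := B.domRestrict₁₂ W W with hT
  have hinj : Function.Injective T := by
    rw [injective_iff_map_eq_zero]
    intro w hw
    have := LinearMap.congr_fun hw w
    exact Subtype.ext (eq_zero_of_moment_mul_self hα hβ this)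
  have hsurj : Function.Surjective T :=
    (LinearMap.injective_iff_surjective_of_finrank_eq_finrank
      (Subspace.dual_finrank_eq (K := ℝ) (V := W)).symm).1 hinj
  obtain ⟨w, hw⟩ := hsurj ((B (mono ℝ k)).domRestrict W)
  refine ⟨mono ℝ k - w, by simp [w.2], fun q hq => ?_⟩
  have h1 : moment hα hβ (w * q) = moment hα hβ (mono ℝ k * q) :=
    LinearMap.congr_fun hw ⟨q, hq⟩
  rw [sub_mul, map_sub, h1, sub_self]

lemma jacobiOpPoly_eq_smul_of_orthogonal (hα : -(1 / 2) ≤ α) (hβ : -(1 / 2) ≤ β) {k : ℕ × ℕ}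
    {p : MvPolynomial (Fin 2) ℝ} (hp : p - mono ℝ k ∈ lowSpan ℝ k)
    (hp' : ∀ q ∈ lowSpan ℝ k, moment hα hβ (p * q) = 0) :
    jacobiOpPoly α β p = eigval α β k • p := by
  rw [← sub_eq_zero]
  change jacobiLin ℝ α β p - eigval α β k • p = 0
  have hmem : jacobiLin ℝ α β p - eigval α β k • p ∈ lowSpan ℝ k := by
    have h1 := jacobiLin_mem_lowSpan α β hp
    have h2 := jacobiOpPoly_mono_sub_mem (𝕜 := ℝ) α β k
    have h3 := (lowSpan ℝ k).smul_mem (eigval α β k) hp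
    have := sub_mem (add_mem h1 h2) h3
    rw [map_sub, smul_sub] at this
    convert this using 1
    change _ = jacobiLin ℝ α β p - jacobiLin ℝ α β (mono ℝ k)
      + (jacobiLin ℝ α β (mono ℝ k) - eigval α β k • mono ℝ k) - _
    abel
  set d := jacobiLin ℝ α β p - eigval α β k • p with hd
  apply eq_zero_of_moment_mul_self hα hβ
  -- Expand only the second factor of `d * d`: symmetry moves the operator onto the first `d`, and
  -- `p` is orthogonal both to the image of `d` and to `d` itself, which are lower polynomials.
  nth_rw 2 [hd]
  rw [mul_sub, map_sub, moment_mul_jacobiLin, hp' _ (jacobiLin_mem_lowSpan α β hmem), mul_comm,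
    smul_mul_assoc, map_smul, hp' _ hmem, smul_zero, sub_zero]

/-! ### Extension of scalars -/

lemma polyFun_map (p : MvPolynomial (Fin 2) ℝ) (z : ℝ × ℝ) :
    polyFun (map (algebraMap ℝ 𝕜) p) z = ((polyFun p z : ℝ) : 𝕜) := by
  induction p using MvPolynomial.induction_on with
  | C a => simp
  | add p q hp hq => simp [hp, hq]
  | mul_X p i hp => fin_cases i <;> simp [hp]

lemma map_mono (k : ℕ × ℕ) : map (algebraMap ℝ 𝕜) (mono ℝ k) = mono 𝕜 k := by
  simp [mono]

lemma map_mem_lowSpan {k : ℕ × ℕ} {p : MvPolynomial (Fin 2) ℝ} (hp : p ∈ lowSpan ℝ k) :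
    map (algebraMap ℝ 𝕜) p ∈ lowSpan 𝕜 k := by
  induction hp using Submodule.span_induction with
  | mem p hp =>
    obtain ⟨j, hj, rfl⟩ := hp
    rw [map_mono]
    exact mono_mem_lowSpan hj
  | zero => rw [map_zero]; exact zero_mem _
  | add p q _ _ hp hq => rw [map_add]; exact add_mem hp hq
  | smul c p _ hp => rw [smul_eq_C_mul, map_mul, map_C]; exact C_mul_mem _ hp

lemma map_jacobiOpPoly (α β : ℝ) (p : MvPolynomial (Fin 2) ℝ) :
    map (algebraMap ℝ 𝕜) (jacobiOpPoly α β p)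
      = jacobiOpPoly α β (map (algebraMap ℝ 𝕜) p) := by
  simp [jacobiOpPoly, pderiv_map]

/-- Conjugation is trivial on real values, so orthogonality of real polynomials carries over to `𝕜`.
-/
lemma wInner_map (hα : -(1 / 2) ≤ α) (hβ : -(1 / 2) ≤ β) (p q : MvPolynomial (Fin 2) ℝ) :
    wInner α β (polyFun (map (algebraMap ℝ 𝕜) p)) (polyFun (map (algebraMap ℝ 𝕜) q))
      = (((∫ z in region, weight α β z)⁻¹ * moment hα hβ (p * q) : ℝ) : 𝕜) := by
  have e (z : ℝ × ℝ) : ((polyFun p z : ℝ) : 𝕜) * (starRingEnd 𝕜) ((polyFun q z : ℝ) : 𝕜)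
      * (weight α β z : 𝕜) = ((polyFun (p * q) z * weight α β z : ℝ) : 𝕜) := by
    rw [RCLike.conj_ofReal, polyFun_mul]; push_cast; rfl
  simp only [wInner, polyFun_map, e]
  rw [integral_ofReal, RCLike.ofReal_mul]
  rfl

end

end GenJacobi

end

/-! ### Assembly of the theorem. -/

open GenJacobi

theorem theorem5p6 {𝕜 : Type*} [RCLike 𝕜] (α β : ℝ) (hα : -(1 / 2) ≤ α) (hβ : -(1 / 2) ≤ β) :
    -- the inner product is well defined
    (MeasureTheory.IntegrableOn (GenJacobi.weight α β) GenJacobi.region ∧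
      0 < ∫ z in GenJacobi.region, GenJacobi.weight α β z) ∧
    ∃ P : ℕ × ℕ → MvPolynomial (Fin 2) 𝕜,
      -- leading terms
      (∀ k, P k ∈ GenJacobi.PiStar 𝕜 k ∧ GenJacobi.HasLeadingTerm (P k) 1 k) ∧
      -- eigenfunctions, for the operator in divergence form and in explicit form
      (∀ k, ∀ z ∈ GenJacobi.regionInt,
        GenJacobi.jacobiOp α β (GenJacobi.polyFun (P k)) z =
          (GenJacobi.eigval α β k : 𝕜) * GenJacobi.polyFun (P k) z) ∧
      (∀ k, GenJacobi.jacobiOpPoly α β (P k) = (GenJacobi.eigval α β k : 𝕜) • P k) ∧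
      -- mutual orthogonality
      (∀ k j, k ≠ j →
        GenJacobi.wInner α β (GenJacobi.polyFun (P k)) (GenJacobi.polyFun (P j)) = 0) ∧
      -- the leading terms and mutual orthogonality determine the whole family
      (∀ Q : ℕ × ℕ → MvPolynomial (Fin 2) 𝕜,
        (∀ k, Q k ∈ GenJacobi.PiStar 𝕜 k ∧ GenJacobi.HasLeadingTerm (Q k) 1 k) →
        (∀ k j, k ≠ j →
          GenJacobi.wInner α β (GenJacobi.polyFun (Q k)) (GenJacobi.polyFun (Q j)) = 0) →
        Q = P) ∧
      -- each member is determined by its leading term and orthogonality to lower monomials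
      (∀ (k : ℕ × ℕ) (q : MvPolynomial (Fin 2) 𝕜),
        q ∈ GenJacobi.PiStar 𝕜 k → GenJacobi.HasLeadingTerm q 1 k →
        (∀ j, GenJacobi.StarLT j k →
          GenJacobi.wInner α β (GenJacobi.polyFun q)
            (GenJacobi.polyFun (GenJacobi.mono 𝕜 j)) = 0) →
        q = P k) := by
  choose p hp horth using exists_orthogonal hα hβ
  have hlow (k) : MvPolynomial.map (algebraMap ℝ 𝕜) (p k) - mono 𝕜 k ∈ lowSpan 𝕜 k := by
    simpa [map_mono] using map_mem_lowSpan (𝕜 := 𝕜) (hp k)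
  have heig (k) : jacobiOpPoly α β (MvPolynomial.map (algebraMap ℝ 𝕜) (p k))
      = (eigval α β k : 𝕜) • MvPolynomial.map (algebraMap ℝ 𝕜) (p k) := by
    rw [← map_jacobiOpPoly, jacobiOpPoly_eq_smul_of_orthogonal hα hβ (hp k) (horth k),
      MvPolynomial.smul_eq_C_mul, MvPolynomial.smul_eq_C_mul, map_mul, MvPolynomial.map_C]
  -- The whole of `p j`, leading monomial included, lies in the span below `k`; as the order is
  -- linear, this settles every pair of distinct indices.
  have horth' (k j) (h : StarLT j k) : moment hα hβ (p k * p j) = 0 := by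
    have := add_mem (lowSpan_mono h (hp j)) (mono_mem_lowSpan h)
    rw [sub_add_cancel] at this
    exact horth k _ this
  have hort (k j) (h : k ≠ j) : wInner α β (polyFun (MvPolynomial.map (algebraMap ℝ 𝕜) (p k)))
      (polyFun (MvPolynomial.map (algebraMap ℝ 𝕜) (p j))) = 0 := by
    rw [wInner_map hα hβ]
    rcases starLT_trichotomy h with h | h
    · rw [mul_comm (p k), horth' j k h]; simp
    · rw [horth' k j h]; simp
  have hmono := wInner_mono_eq_zero_of_orthogonal hα hβ hlow hort
  refine ⟨⟨integrableOn_weight hα hβ, integral_weight_pos hα hβ⟩,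
    fun k => MvPolynomial.map (algebraMap ℝ 𝕜) (p k), fun k => ?_, fun k z hz => ?_, heig, hort,
    fun Q hQ hQ' => ?_, fun k q hq hq' hq'' => ?_⟩
  · simpa using mem_piStar_and_hasLeadingTerm (hlow k)
  · rw [jacobiOp_polyFun α β _ hz, heig, polyFun_smul]
  · have hQl (k) := sub_mono_mem_lowSpan (hQ k).1 (hQ k).2
    funext k
    exact eq_of_wInner_mono_eq_zero hα hβ (hQl k) (hlow k)
      (wInner_mono_eq_zero_of_orthogonal hα hβ hQl hQ' k) (hmono k)
  · exact eq_of_wInner_mono_eq_zero hα hβ (sub_mono_mem_lowSpan hq hq') (hlow k) hq'' (hmono k)
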